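/- Let $t\ge 1$ and let $H$ be a finite $t$-uniform hypergraph (without repeated edges) with at least $t+1$ vertices and at least one edge. Write $v(\cdot)$ and $e(\cdot)$ for the numbers of vertices and edges, and define the $t$-density of $H$ by $$m_t(H)=\max\left\{\frac{e(H')-1}{v(H')-t} : H'\subseteq H,\ v(H')\ge t+1\right\},$$ where $H'$ ranges over all (not necessarily induced) subhypergraphs of $H$. A hypergraph is $H$-free if it has no (not necessarily induced) subhypergraph isomorphic to $H$. Let $\mathrm{ex}(n,H)$ be the maximum number of edges of an $H$-free $t$-uniform hypergraph on $n$ vertices, and let $f_{n,m}(H)$ be the number of (labelled) $H$-free $t$-uniform hypergraphs on the vertex set $[n]=\{1,\dots,n\}$ with exactly $m$ edges. If $m_t(H)=0$ (that is, if $H$ has exactly one edge), the expression $n^{t-1/m_t(H)}$ is read as $0$. For real $x\ge 0$ and an integer $m\ge 0$ put $\binom{x}{m}=\binom{\lfloor x\rfloor}{m}$. **Theorem.** For every such $t$ and $H$ and every $\delta>0$ there exists a constant $C>0$ such that for all integers $n,m\ge 0$ with $m\ge C\,n^{t-1/m_t(H)}$, $$\binom{\mathrm{ex}(n,H)}{m}\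 \le\ f_{n,m}(H)\ \le\ \binom{\mathrm{ex}(n,H)+\delta n^t}{m}.$$ -/

import Mathlib

namespace Hypergraph

noncomputable section

/-- Every edge has exactly `t` vertices. -/
def IsUniform {α : Type*} (t : ℕ) (H : Hypergraph α) : Prop :=
  ∀ e ∈ H.edgeSet, e.encard = t

/-- The subhypergraph relation: some of the vertices together with some of the edges (a structure
of type `Hypergraph` always has its edges inside its own vertex set; not necessarily induced). -/
def IsSubhypergraph {α : Type*} (H' H : Hypergraph α) : Prop :=
  H'.vertexSet ⊆ H.vertexSet ∧ H'.edgeSet ⊆ H.edgeSet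

/-- `G` contains a copy of `H`, i.e. a (not necessarily induced) subhypergraph that is the image
of `H` under a map injective on the vertices of `H`. -/
def ContainsCopy {α β : Type*} (G : Hypergraph β) (H : Hypergraph α) : Prop :=
  ∃ f : α → β, Set.InjOn f H.vertexSet ∧ IsSubhypergraph (H.image f) G

/-- The `H`-free `t`-uniform hypergraphs with vertex set `[n]`. -/
def freeHypergraphs {α : Type*} (t n : ℕ) (H : Hypergraph α) : Set (Hypergraph (Fin n)) :=
  {G | G.vertexSet = Set.univ ∧ G.IsUniform t ∧ ¬ G.ContainsCopy H}

/-- The Turán number `ex(n, H)`: the largest number of edges of an `H`-free `t`-uniform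
hypergraph on `n` vertices. The set is bounded, and it is nonempty as soon as `H` has an edge. -/
def turanNumber {α : Type*} (t n : ℕ) (H : Hypergraph α) : ℕ :=
  sSup {k | ∃ G ∈ freeHypergraphs t n H, G.edgeSet.ncard = k}

/-- `f_{n,m}(H)`: the number of (labelled) `H`-free `t`-uniform hypergraphs on the vertex set
`[n]` with exactly `m` edges. -/
def numFree {α : Type*} (t n m : ℕ) (H : Hypergraph α) : ℕ :=
  {G ∈ freeHypergraphs t n H | G.edgeSet.ncard = m}.ncard

/-- The `t`-density `m_t(H)`, the maximum of `(e(H') - 1) / (v(H') - t)` over the subhypergraphs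
`H' ⊆ H` with `v(H') ≥ t + 1`. For a finite `H` with at least `t + 1` vertices the supremum is
over a finite nonempty set, so it is a maximum. -/
def tDensity {α : Type*} (t : ℕ) (H : Hypergraph α) : ℝ :=
  sSup {x : ℝ | ∃ H' : Hypergraph α, IsSubhypergraph H' H ∧ t + 1 ≤ H'.vertexSet.ncard ∧
    x = ((H'.edgeSet.ncard : ℝ) - 1) / ((H'.vertexSet.ncard : ℝ) - t)}

/-- The quantity `n ^ (t - 1 / m_t(H))`. If `m_t(H) = 0` (for nonempty `H` this means that `H` has
just one edge), then `1 / m_t(H)` is read as `∞` and the power as `0`. -/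
def edgeThreshold {α : Type*} (t n : ℕ) (H : Hypergraph α) : ℝ :=
  if tDensity t H = 0 then 0 else (n : ℝ) ^ ((t : ℝ) - 1 / tDensity t H)

end

end Hypergraph

/-! The lower bound counts the `m`-subsets of one extremal family. The upper bound is the method of
hypergraph containers. Take the `t`-subsets of `[n]` as vertices and the edge sets of copies of `H`
as hyperedges; an `H`-free hypergraph is then an independent set. With `N = n ^ t` and `p = n ^ (-1
/ m_t(H))`, each independent set `I` has a fingerprint of `O(p * N)` elements that determines a
container of at most `ex(n, H) + δ' * N` elements around `I`. Once `m` is a large multiple of `p * N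
= n ^ (t - 1 / m_t(H))`, the choice of fingerprint costs less than a slight enlargement of the upper
entry in the binomial coefficient.

Containers are made by repeated shrinking. As long as `U` has more than `ex(n, H) + δ' * N`
elements, `supersaturation` gives a positive proportion of all embeddings of `H` inside `U`. The
density condition says exactly that these copies have small codegrees at scale `p`
(`weightDeg_copyWeight_le`), so `SpreadWeight.containable` removes a fixed proportion of `N` from
`U`. Boundedly many rounds suffice (`Containable.iterate`).

One round is an induction on uniformity. Query vertices of large active degree: either `I` avoids
all of them, and the others form the container, or `I` contains `⌈p * N⌉` successive picks and is
independent in the sum of their links, a hypergraph of uniformity one less with the same kind of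
degree bounds. `sum_choose_mul_choose_le` does the final arithmetic. A single edge has `m_t(H) = 0`
and is treated directly. -/

section Containers

variable {V : Type*}

/-- Every member `I` of the family has a fingerprint `g I ⊆ I` of at most `s` elements and a
container `c I ⊇ I` with property `Q`, and both can be recovered from any set between the
fingerprint and `I`. -/
def Containable (Q : Finset V → Prop) (s : ℕ) (𝓘 : Set (Finset V)) : Prop :=
  ∃ g c : Finset V → Finset V, ∀ I ∈ 𝓘, g I ⊆ I ∧ (g I).card ≤ s ∧ I ⊆ c I ∧ Q (c I) ∧
    ∀ J, g I ⊆ J → J ⊆ I → g J = g I ∧ c J = c I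

/-! ### Building containers by adaptive queries -/

namespace Containable

variable {Q Q' : Finset V → Prop} {s s' : ℕ} {𝓘 𝓙 : Set (Finset V)}

theorem mono (h : Containable Q s 𝓘) (hs : s ≤ s') (h𝓘 : 𝓙 ⊆ 𝓘) : Containable Q s' 𝓙 := by
  obtain ⟨g, c, h⟩ := h
  refine ⟨g, c, fun I hI => ?_⟩
  obtain ⟨h1, h2, h3⟩ := h I (h𝓘 hI)
  exact ⟨h1, h2.trans hs, h3⟩

theorem leaf (s : ℕ) (c : Finset V) (hQ : Q c) (h : ∀ I ∈ 𝓘, I ⊆ c) : Containable Q s 𝓘 :=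
  ⟨fun _ => ∅, fun _ => c, fun I hI => by simp [h I hI, hQ]⟩

/-- Think of a decision tree asking whether `v ∈ I`. A yes is recorded by putting `v` into the
fingerprint; a no is free, because every `J ⊆ I` also omits `v`. Hence only the yes branch loses a
unit of budget. -/
theorem query [DecidableEq V] (v : V) (h1 : Containable Q s {I ∈ 𝓘 | v ∈ I})
    (h0 : Containable Q (s + 1) {I ∈ 𝓘 | v ∉ I}) : Containable Q (s + 1) 𝓘 := by
  obtain ⟨g1, c1, h1⟩ := h1
  obtain ⟨g0, c0, h0⟩ := h0
  refine ⟨fun I => if v ∈ I then insert v (g1 I) else g0 I,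
    fun I => if v ∈ I then c1 I else c0 I, fun I hI => ?_⟩
  by_cases hv : v ∈ I
  · obtain ⟨a1, a2, a3, a4, a5⟩ := h1 I ⟨hI, hv⟩
    simp only [hv, if_true]
    refine ⟨Finset.insert_subset hv a1, (Finset.card_insert_le _ _).trans (by omega), a3, a4,
      fun J hJ hJI => ?_⟩
    have hvJ : v ∈ J := hJ (Finset.mem_insert_self _ _)
    obtain ⟨b1, b2⟩ := a5 J ((Finset.subset_insert _ _).trans hJ) hJI
    simp [hvJ, b1, b2]
  · obtain ⟨a1, a2, a3, a4, a5⟩ := h0 I ⟨hI, hv⟩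
    simp only [hv, if_false]
    refine ⟨a1, a2, a3, a4, fun J hJ hJI => ?_⟩
    have hvJ : v ∉ J := fun h => hv (hJI h)
    simpa [hvJ] using a5 J hJ hJI

/-- Querying the elements of `A` one after another stops at the first yes, so a single unit of
budget pays for all of `A`, however large. -/
theorem branch [DecidableEq V] (A : Finset V) (h1 : ∀ v ∈ A, Containable Q s {I ∈ 𝓘 | v ∈ I})
    (h0 : Containable Q (s + 1) {I ∈ 𝓘 | Disjoint I A}) : Containable Q (s + 1) 𝓘 := by
  induction A using Finset.induction_on generalizing 𝓘 with
  | empty => simpa using h0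
  | insert x A hx ih =>
    refine query x (h1 x (Finset.mem_insert_self _ _)) (ih (fun v hv => ?_) ?_)
    · exact (h1 v (Finset.mem_insert_of_mem hv)).mono le_rfl fun I hI => ⟨hI.1.1, hI.2⟩
    · refine h0.mono le_rfl fun I hI => ⟨hI.1.1, ?_⟩
      rw [Finset.disjoint_insert_right]
      exact ⟨hI.1.2, hI.2⟩

/-- The second stage depends on `I` only through the first container, and any `J` between the united
fingerprints and `I` recovers that container. Recoverability from all such `J`, not just from the
fingerprint, is what makes stages compose. -/
theorem bind [DecidableEq V] (h : Containable Q s 𝓘)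
    (h' : ∀ U, Q U → Containable Q' s' {I ∈ 𝓘 | I ⊆ U}) : Containable Q' (s + s') 𝓘 := by
  classical
  obtain ⟨g, c, h⟩ := h
  have h'' : ∀ U, ∃ g' c' : Finset V → Finset V, Q U → ∀ I ∈ {I ∈ 𝓘 | I ⊆ U},
      g' I ⊆ I ∧ (g' I).card ≤ s' ∧ I ⊆ c' I ∧ Q' (c' I) ∧
      ∀ J, g' I ⊆ J → J ⊆ I → g' J = g' I ∧ c' J = c' I := by
    intro U
    by_cases hU : Q U
    · obtain ⟨g', c', h1⟩ := h' U hU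
      exact ⟨g', c', fun _ => h1⟩
    · exact ⟨id, id, fun h => absurd h hU⟩
  choose g' c' h'' using h''
  refine ⟨fun I => g I ∪ g' (c I) I, fun I => c' (c I) I, fun I hI => ?_⟩
  obtain ⟨a1, a2, a3, a4, a5⟩ := h I hI
  obtain ⟨b1, b2, b3, b4, b5⟩ := h'' (c I) a4 I ⟨hI, a3⟩
  refine ⟨Finset.union_subset a1 b1, (Finset.card_union_le _ _).trans (by omega), b3, b4,
    fun J hJ hJI => ?_⟩
  obtain ⟨e1, e2⟩ := a5 J (Finset.subset_union_left.trans hJ) hJI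
  obtain ⟨e3, e4⟩ := b5 J (Finset.subset_union_right.trans hJ) hJI
  simp only [e1, e2, e3, e4, and_self]

theorem imp (h : Containable Q s 𝓘) (hQ : ∀ U, Q U → Q' U) : Containable Q' s 𝓘 := by
  obtain ⟨g, c, h⟩ := h
  exact ⟨g, c, fun I hI => let ⟨a1, a2, a3, a4, a5⟩ := h I hI; ⟨a1, a2, a3, hQ _ a4, a5⟩⟩

end Containable

/-! ### Degrees and links in weighted hypergraphs -/

variable [DecidableEq V] [Fintype V]

/-- The degree of `X` in a weighted hypergraph; `weightDeg w ∅` is the total weight. -/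
def weightDeg (w : Finset V → ℝ) (X : Finset V) : ℝ := ∑ e with X ⊆ e, w e

section weightDeg

variable {w a b : Finset V → ℝ} {X Y : Finset V}

theorem weightDeg_empty : weightDeg w ∅ = ∑ e, w e := by simp [weightDeg]

theorem weightDeg_nonneg (hw : ∀ e, 0 ≤ w e) : 0 ≤ weightDeg w X :=
  Finset.sum_nonneg fun _ _ => hw _

theorem weightDeg_anti (hw : ∀ e, 0 ≤ w e) (h : X ⊆ Y) : weightDeg w Y ≤ weightDeg w X :=
  Finset.sum_le_sum_of_subset_of_nonneg
    (fun e he => by simp at he ⊢; exact h.trans he) fun _ _ _ => hw _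

theorem weightDeg_mono (h : ∀ e, a e ≤ w e) : weightDeg a X ≤ weightDeg w X :=
  Finset.sum_le_sum fun _ _ => h _

theorem weightDeg_add : weightDeg (fun e => a e + b e) X = weightDeg a X + weightDeg b X :=
  Finset.sum_add_distrib

theorem eq_zero_of_weightDeg_eq_zero (hw : ∀ e, 0 ≤ w e) (h : weightDeg w X = 0) {e : Finset V}
    (he : X ⊆ e) : w e = 0 :=
  (Finset.sum_eq_zero_iff_of_nonneg fun _ _ => hw _).1 h e (by simpa using he)

/-- The link of the vertex `v`. -/
def linkWeight (a : Finset V → ℝ) (v : V) (f : Finset V) : ℝ := if v ∈ f then 0 else a (insert v f)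

theorem weightDeg_link (v : V) :
    weightDeg (linkWeight a v) X = if v ∈ X then 0 else weightDeg a (insert v X) := by
  split_ifs with hv
  · refine Finset.sum_eq_zero fun f hf => ?_
    simp only [Finset.mem_filter, Finset.mem_univ, true_and] at hf
    simp [linkWeight, hf hv]
  · unfold weightDeg linkWeight
    rw [Finset.sum_ite]
    simp only [Finset.sum_const_zero, zero_add]
    refine Finset.sum_nbij' (fun f => insert v f) (fun e => e.erase v) ?_ ?_ ?_ ?_ ?_
    · intro f hf
      simp only [Finset.mem_filter, Finset.mem_univ, true_and] at hf ⊢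
      exact Finset.insert_subset_insert _ hf.1
    · intro e he
      simp only [Finset.mem_filter, Finset.mem_univ, true_and] at he ⊢
      refine ⟨fun x hx => Finset.mem_erase.2 ⟨fun h => hv (h ▸ hx),
        he (Finset.mem_insert_of_mem hx)⟩, by simp⟩
    · intro f hf
      simp only [Finset.mem_filter, Finset.mem_univ, true_and] at hf
      exact Finset.erase_insert hf.2
    · intro e he
      simp only [Finset.mem_filter, Finset.mem_univ, true_and] at he
      exact Finset.insert_erase (he (Finset.mem_insert_self _ _))
    · intro f hf
      rfl

theorem sum_weightDeg_eq : ∑ X, weightDeg b X = ∑ f, b f * 2 ^ f.card := by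
  unfold weightDeg
  simp_rw [Finset.sum_filter]
  rw [Finset.sum_comm]
  refine Finset.sum_congr rfl fun f _ => ?_
  rw [← Finset.sum_filter, Finset.sum_const]
  have : (Finset.univ.filter fun X => X ⊆ f) = f.powerset := by ext; simp
  rw [this, Finset.card_powerset, nsmul_eq_mul, mul_comm]
  push_cast; rfl

theorem sum_weightDeg_singleton (U : Finset V) (h : ∀ e, a e ≠ 0 → e ⊆ U) :
    ∑ v ∈ U, weightDeg a {v} = ∑ e, a e * e.card := by
  unfold weightDeg
  simp_rw [Finset.sum_filter]
  rw [Finset.sum_comm]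
  refine Finset.sum_congr rfl fun e _ => ?_
  by_cases he : a e = 0
  · simp [he]
  rw [← Finset.sum_filter, Finset.sum_const]
  have : (U.filter fun v => {v} ⊆ e) = e := by
    ext v
    simp only [Finset.mem_filter, Finset.singleton_subset_iff, and_iff_right_iff_imp]
    exact fun hv => h e he hv
  rw [this, nsmul_eq_mul, mul_comm]

end weightDeg

/-! ### One round of the container lemma -/

/-- An `i`-uniform weighted hypergraph on `U` whose degrees are controlled in terms of the
parameters `K`, `p`, `N`. -/
structure SpreadWeight (w : Finset V → ℝ) (i : ℕ) (U : Finset V) (K p N : ℝ) : Prop where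
  nonneg : ∀ e, 0 ≤ w e
  supp : ∀ e, w e ≠ 0 → e.card = i ∧ e ⊆ U
  deg_le : ∀ X : Finset V, X.Nonempty →
    weightDeg w X ≤ K * p ^ (X.card - 1) * weightDeg w ∅ / N

/-- The subsets of `U` containing no edge of positive weight. -/
def indepSets (w : Finset V → ℝ) (U : Finset V) : Set (Finset V) :=
  {I | I ⊆ U ∧ ∀ e, w e ≠ 0 → ¬ e ⊆ I}

/-- The state of the process reducing the uniformity: `a` is the weight of the edges of `w` still
active, `b` the collected weight of links. A set `X` is saturated when `D X < weightDeg b X`. -/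
structure LinkState (w : Finset V → ℝ) (i : ℕ) (U : Finset V) (D : Finset V → ℝ)
    (K p N : ℝ) (a b : Finset V → ℝ) : Prop where
  a_nonneg : ∀ e, 0 ≤ a e
  a_le : ∀ e, a e ≤ w e
  b_nonneg : ∀ e, 0 ≤ b e
  b_supp : ∀ e, b e ≠ 0 → e.card = i ∧ e ⊆ U
  b_deg : ∀ X : Finset V, X.Nonempty →
    weightDeg b X ≤ D X + K * p ^ X.card * weightDeg w ∅ / N
  sat : ∀ X : Finset V, X.Nonempty → D X < weightDeg b X → weightDeg a X = 0
  total : weightDeg w ∅ ≤ weightDeg a ∅ + weightDeg b ∅ +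
    ∑ X with X.Nonempty ∧ D X < weightDeg b X, weightDeg w X

open Classical in
/-- The weight remaining active after the vertex `v` is picked and `b` updated. -/
noncomputable def activeAfter (D : Finset V → ℝ) (a b : Finset V → ℝ) (v : V) (e : Finset V) : ℝ :=
  if v ∈ e ∨ ∃ X : Finset V, X.Nonempty ∧ X ⊆ e ∧ D X < weightDeg b X then 0 else a e

variable {w : Finset V → ℝ} {i : ℕ} {U : Finset V} {D : Finset V → ℝ} {K p N : ℝ}
  {a b : Finset V → ℝ}

/-- Each pick adds the active link of `v` to `b`, then deactivates the edges through `v` and those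
containing a saturated set. The active weight lost at `v` reappears as total weight of `b`; the rest
is charged to newly saturated sets. -/
theorem LinkState.pick (hw : SpreadWeight w (i + 1) U K p N)
    (h : LinkState w i U D K p N a b) (v : V) :
    LinkState w i U D K p N (activeAfter D a (fun f => b f + linkWeight a v f) v)
      (fun f => b f + linkWeight a v f) := by
  classical
  set b' : Finset V → ℝ := fun f => b f + linkWeight a v f with hb'
  have hlink : ∀ f, 0 ≤ linkWeight a v f := fun f => by
    unfold linkWeight; split_ifs; exacts [le_rfl, h.a_nonneg _]
  have hdeg : ∀ X, weightDeg b' X = weightDeg b X + weightDeg (linkWeight a v) X :=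
    fun X => weightDeg_add
  have hdegle : ∀ X, weightDeg b X ≤ weightDeg b' X := fun X => by
    rw [hdeg]; linarith [weightDeg_nonneg (X := X) hlink]
  refine ⟨?_, ?_, ?_, ?_, ?_, ?_, ?_⟩
  · intro e; unfold activeAfter; split_ifs; exacts [le_rfl, h.a_nonneg _]
  · intro e; unfold activeAfter; split_ifs; exacts [hw.nonneg _, h.a_le _]
  · intro e; exact add_nonneg (h.b_nonneg e) (hlink e)
  · intro e he
    by_cases hbe : b e = 0
    · have hl : linkWeight a v e ≠ 0 := by simpa [hb', hbe] using he
      unfold linkWeight at hl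
      split_ifs at hl with hv
      · exact absurd rfl hl
      have hwe : w (insert v e) ≠ 0 := by
        have := h.a_nonneg (insert v e)
        have := h.a_le (insert v e)
        intro h0
        exact hl (by linarith)
      obtain ⟨h1, h2⟩ := hw.supp _ hwe
      rw [Finset.card_insert_of_notMem hv] at h1
      exact ⟨by omega, (Finset.subset_insert _ _).trans h2⟩
    · exact h.b_supp e hbe
  · intro X hX
    rw [hdeg, weightDeg_link]
    split_ifs with hv
    · simpa using h.b_deg X hX
    -- A saturated `X` lies in no active edge, so its degree no longer grows. An unsaturated one can
    -- overshoot `D X` by at most one link degree, which is at most the degree of `insert v X` in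
    -- `w`.
    by_cases hsat : D X < weightDeg b X
    · have h0 := h.sat X hX hsat
      have h1 := weightDeg_anti h.a_nonneg (Finset.subset_insert v X)
      linarith [h.b_deg X hX]
    · have h1 := weightDeg_mono (X := insert v X) h.a_le
      have h2 := hw.deg_le (insert v X) (Finset.insert_nonempty _ _)
      rw [Finset.card_insert_of_notMem hv, Nat.add_sub_cancel] at h2
      linarith
  · intro X hX hsat
    refine Finset.sum_eq_zero fun e he => ?_
    simp only [Finset.mem_filter, Finset.mem_univ, true_and] at he
    unfold activeAfter
    rw [if_pos (Or.inr ⟨X, hX, he, hsat⟩)]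
  · set S := Finset.univ.filter fun X : Finset V => X.Nonempty ∧ D X < weightDeg b X with hS
    set S' := Finset.univ.filter fun X : Finset V => X.Nonempty ∧ D X < weightDeg b' X with hS'
    have hSS : S ⊆ S' := fun X hX => by
      simp only [hS, hS', Finset.mem_filter, Finset.mem_univ, true_and] at hX ⊢
      exact ⟨hX.1, hX.2.trans_le (hdegle X)⟩
    rw [← Finset.sum_sdiff hSS, hdeg, weightDeg_link]
    simp only [Finset.notMem_empty, if_false, insert_empty_eq]
    have key : weightDeg a ∅ ≤ weightDeg (activeAfter D a b' v) ∅ + weightDeg a {v} +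
        ∑ X ∈ S' \ S, weightDeg a X := by
      rw [weightDeg_empty, weightDeg_empty]
      unfold weightDeg
      simp_rw [Finset.sum_filter]
      rw [Finset.sum_comm, ← Finset.sum_add_distrib, ← Finset.sum_add_distrib]
      refine Finset.sum_le_sum fun e _ => ?_
      have hs : 0 ≤ ∑ X ∈ S' \ S, if X ⊆ e then a e else 0 :=
        Finset.sum_nonneg fun X _ => by split_ifs; exacts [h.a_nonneg _, le_rfl]
      have hae := h.a_nonneg e
      by_cases hv : v ∈ e
      · have : (if {v} ⊆ e then a e else 0) = a e := by simp [hv]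
        have h2 : 0 ≤ activeAfter D a b' v e := by
          unfold activeAfter; split_ifs; exacts [le_rfl, hae]
        linarith
      · have h3 : 0 ≤ (if {v} ⊆ e then a e else 0) := by split_ifs; exacts [hae, le_rfl]
        by_cases hX : ∃ X : Finset V, X.Nonempty ∧ X ⊆ e ∧ D X < weightDeg b' X
        · obtain ⟨X, hX1, hX2, hX3⟩ := hX
          have h2 : 0 ≤ activeAfter D a b' v e := by
            unfold activeAfter; split_ifs; exacts [le_rfl, hae]
          by_cases hsat : D X < weightDeg b X
          · have := eq_zero_of_weightDeg_eq_zero h.a_nonneg (h.sat X hX1 hsat) hX2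
            linarith
          · have hmem : X ∈ S' \ S := by
              simp only [hS, hS', Finset.mem_sdiff, Finset.mem_filter, Finset.mem_univ, true_and]
              exact ⟨⟨hX1, hX3⟩, fun h => hsat h.2⟩
            have h4 := Finset.single_le_sum (f := fun X => if X ⊆ e then a e else 0)
              (fun X _ => by split_ifs; exacts [hae, le_rfl]) hmem
            simp only [hX2, if_true] at h4
            linarith
        · have : activeAfter D a b' v e = a e := by
            unfold activeAfter
            rw [if_neg]
            rintro (h | h)
            exacts [hv h, hX h]
          linarith
    have h5 : ∑ X ∈ S' \ S, weightDeg a X ≤ ∑ X ∈ S' \ S, weightDeg w X :=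
      Finset.sum_le_sum fun X _ => weightDeg_mono h.a_le
    have h6 := h.total
    linarith


/-- Saturated sets are few: if `X` is saturated, its degree in `w` is at most its degree in `b`
divided by `2 ^ (i + 3) * K * p`, while the degrees in `b` add up to `2 ^ i` times the total of `b`.
With the bound on that total, saturation costs at most a quarter of the weight of `w`, and `b`
itself at most another quarter. -/
theorem LinkState.half_le_active (hw : SpreadWeight w (i + 1) U K p N) (hK : 0 < K) (hp : 0 < p)
    (hp' : p * (8 * K) ≤ 1) (hW : 0 < weightDeg w ∅)
    (h : LinkState w i U
      (fun X => 2 ^ (i + 3) * K ^ 2 * p ^ X.card * weightDeg w ∅ / N) K p N a b)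
    (hb : weightDeg b ∅ ≤ 2 * p * K * weightDeg w ∅) :
    weightDeg w ∅ / 2 ≤ weightDeg a ∅ := by
  classical
  set W := weightDeg w ∅ with hWdef
  have hsum : ∑ X with X.Nonempty ∧ 2 ^ (i + 3) * K ^ 2 * p ^ X.card * W / N < weightDeg b X,
      weightDeg w X ≤ W / 4 := by
    have h1 : ∀ X ∈ Finset.univ.filter (fun X : Finset V => X.Nonempty ∧
        2 ^ (i + 3) * K ^ 2 * p ^ X.card * W / N < weightDeg b X),
        weightDeg w X ≤ weightDeg b X / (2 ^ (i + 3) * K * p) := by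
      intro X hX
      simp only [Finset.mem_filter, Finset.mem_univ, true_and] at hX
      obtain ⟨hX1, hX2⟩ := hX
      rw [le_div_iff₀ (by positivity)]
      refine le_trans ?_ hX2.le
      have h2 := hw.deg_le X hX1
      obtain ⟨j, hj⟩ : ∃ j, X.card = j + 1 := ⟨X.card - 1, by have := hX1.card_pos; omega⟩
      rw [hj] at h2 ⊢
      rw [Nat.add_sub_cancel] at h2
      calc weightDeg w X * (2 ^ (i + 3) * K * p)
          ≤ K * p ^ j * W / N * (2 ^ (i + 3) * K * p) := by gcongr
        _ = 2 ^ (i + 3) * K ^ 2 * p ^ (j + 1) * W / N := by ring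
    calc _ ≤ _ := Finset.sum_le_sum h1
      _ ≤ ∑ X, weightDeg b X / (2 ^ (i + 3) * K * p) :=
          Finset.sum_le_univ_sum_of_nonneg fun X => by
            have := weightDeg_nonneg (X := X) h.b_nonneg
            positivity
      _ = (∑ f, b f * 2 ^ f.card) / (2 ^ (i + 3) * K * p) := by
          rw [← Finset.sum_div, sum_weightDeg_eq]
      _ = (weightDeg b ∅ * 2 ^ i) / (2 ^ (i + 3) * K * p) := by
          rw [weightDeg_empty, Finset.sum_mul]
          congr 1
          refine Finset.sum_congr rfl fun f _ => ?_
          by_cases hf : b f = 0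
          · simp [hf]
          · rw [(h.b_supp f hf).1]
      _ ≤ (2 * p * K * W * 2 ^ i) / (2 ^ (i + 3) * K * p) := by gcongr
      _ = W / 4 := by field_simp; ring
  have h3 : 2 * p * K * W ≤ W / 4 := by nlinarith
  linarith [h.total]

/-- The bound on the container at the end of an unsuccessful run of the process. -/
theorem card_filter_weightDeg_lt (hw : SpreadWeight w (i + 1) U K p N) (hK : 0 < K)
    (hN : 0 < N) (hU : (U.card : ℝ) ≤ N) (hW : 0 < weightDeg w ∅)
    (ha0 : ∀ e, 0 ≤ a e) (ha : ∀ e, a e ≤ w e) (hhalf : weightDeg w ∅ / 2 ≤ weightDeg a ∅) :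
    ((U.filter fun v => weightDeg a {v} < weightDeg w ∅ / (4 * N)).card : ℝ) ≤
      U.card - 1 / (4 * K) * N := by
  classical
  set W := weightDeg w ∅ with hWdef
  have hsupp : ∀ e, a e ≠ 0 → e.card = i + 1 ∧ e ⊆ U := fun e he => by
    refine hw.supp e fun h0 => he ?_
    have h1 := ha e
    have h2 := ha0 e
    linarith
  have h1 : weightDeg a ∅ ≤ ∑ v ∈ U, weightDeg a {v} := by
    rw [sum_weightDeg_singleton U fun e he => (hsupp e he).2, weightDeg_empty]
    refine Finset.sum_le_sum fun e _ => ?_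
    by_cases he : a e = 0
    · simp [he]
    · rw [(hsupp e he).1]
      have := ha0 e
      push_cast
      nlinarith [(Nat.cast_nonneg i : (0 : ℝ) ≤ i)]
  rw [← Finset.sum_filter_add_sum_filter_not U fun v => weightDeg a {v} < W / (4 * N)] at h1
  -- Vertices of low active degree carry at most `W / 4` of a degree sum that is at least `W / 2`.
  -- Each other vertex carries at most `K * W / N`, so there are at least `N / (4 * K)` of those,
  -- and the container misses them all.
  have h2 : ∑ v ∈ U with weightDeg a {v} < W / (4 * N), weightDeg a {v} ≤ W / 4 := by
    calc _ ≤ ((U.filter fun v => weightDeg a {v} < W / (4 * N)).card : ℝ) * (W / (4 * N)) := by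
          rw [← nsmul_eq_mul]
          exact Finset.sum_le_card_nsmul _ _ _ fun v hv => (Finset.mem_filter.1 hv).2.le
      _ ≤ N * (W / (4 * N)) := by
          gcongr
          exact le_trans (by exact_mod_cast Finset.card_filter_le _ _) hU
      _ = W / 4 := by field_simp
  have h3 : ∑ v ∈ U with ¬ weightDeg a {v} < W / (4 * N), weightDeg a {v} ≤
      ((U.filter fun v => ¬ weightDeg a {v} < W / (4 * N)).card : ℝ) * (K * W / N) := by
    rw [← nsmul_eq_mul]
    refine Finset.sum_le_card_nsmul _ _ _ fun v _ => ?_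
    refine (weightDeg_mono ha).trans ?_
    simpa using hw.deg_le {v} (Finset.singleton_nonempty v)
  have h4 : ((U.filter fun v => weightDeg a {v} < W / (4 * N)).card : ℝ) +
      ((U.filter fun v => ¬ weightDeg a {v} < W / (4 * N)).card : ℝ) = U.card := by
    exact_mod_cast Finset.card_filter_add_card_filter_not (s := U)
      (p := fun v => weightDeg a {v} < W / (4 * N))
  set x := ((U.filter fun v => ¬ weightDeg a {v} < W / (4 * N)).card : ℝ)
  have h5 : W / 4 ≤ x * (K * W / N) := by linarith
  have h6 : 1 / (4 * K) * N ≤ x := by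
    have : W / 4 * (N / (K * W)) ≤ x * (K * W / N) * (N / (K * W)) := by gcongr
    calc 1 / (4 * K) * N = W / 4 * (N / (K * W)) := by field_simp
      _ ≤ _ := this
      _ = x := by field_simp
  linarith

/-- A run of the process with `k` picks left. -/
theorem LinkState.containable (hw : SpreadWeight w (i + 1) U K p N) (hK : 0 < K) (hp : 0 < p)
    (hp' : p * (8 * K) ≤ 1) (hpN : 1 ≤ p * N) (hU : (U.card : ℝ) ≤ N) (hW : 0 < weightDeg w ∅)
    {Q : Finset V → Prop} {s : ℕ} (hQ : ∀ c ⊆ U, (c.card : ℝ) ≤ U.card - 1 / (4 * K) * N → Q c)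
    (hrec : ∀ b : Finset V → ℝ, SpreadWeight b i U (4 * (2 ^ (i + 3) * K ^ 2 + K)) p N →
      0 < weightDeg b ∅ → Containable Q s (indepSets b U))
    (k : ℕ) (a b : Finset V → ℝ) (𝓘 : Set (Finset V))
    (h : LinkState w i U
      (fun X => 2 ^ (i + 3) * K ^ 2 * p ^ X.card * weightDeg w ∅ / N) K p N a b)
    (hk : k ≤ ⌈p * N⌉₊)
    (hb1 : (⌈p * N⌉₊ - k : ℝ) * (weightDeg w ∅ / (4 * N)) ≤ weightDeg b ∅)
    (hb2 : weightDeg b ∅ ≤ (⌈p * N⌉₊ - k : ℝ) * (K * weightDeg w ∅ / N))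
    (h𝓘w : 𝓘 ⊆ indepSets w U) (h𝓘b : 𝓘 ⊆ indepSets b U) :
    Containable Q (s + k) 𝓘 := by
  classical
  have hN : 0 < N := by
    by_contra hN
    nlinarith [mul_nonneg hp.le (not_lt.1 hN |> neg_nonneg.2)]
  have hLlt : (⌈p * N⌉₊ : ℝ) < p * N + 1 := Nat.ceil_lt_add_one (by positivity)
  have hLge : p * N ≤ (⌈p * N⌉₊ : ℝ) := Nat.le_ceil _
  induction k generalizing a b 𝓘 with
  | zero =>
    simp only [Nat.cast_zero, sub_zero] at hb1 hb2
    have hb3 : p * weightDeg w ∅ / 4 ≤ weightDeg b ∅ := by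
      refine le_trans ?_ hb1
      calc p * weightDeg w ∅ / 4 = p * N * (weightDeg w ∅ / (4 * N)) := by field_simp
        _ ≤ _ := by gcongr
    -- After all picks the total of `b` is at least `p / 4` times that of `w`. Trading this factor
    -- `p` lowers the exponent from `X.card` to `X.card - 1`, at the price of the factor 4 in the
    -- new constant.
    refine (hrec b ⟨h.b_nonneg, h.b_supp, fun X hX => ?_⟩ ?_).mono (by omega) h𝓘b
    · refine (h.b_deg X hX).trans ?_
      obtain ⟨j, hj⟩ : ∃ j, X.card = j + 1 := ⟨X.card - 1, by have := hX.card_pos; omega⟩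
      rw [hj, Nat.add_sub_cancel]
      calc 2 ^ (i + 3) * K ^ 2 * p ^ (j + 1) * weightDeg w ∅ / N +
            K * p ^ (j + 1) * weightDeg w ∅ / N
          = 4 * (2 ^ (i + 3) * K ^ 2 + K) * p ^ j * (p * weightDeg w ∅ / 4) / N := by ring
        _ ≤ _ := by gcongr
    · exact lt_of_lt_of_le (by positivity) hb3
  | succ k ih =>
    -- The threshold `weightDeg w ∅ / (4 * N)` ensures that every pick feeds enough weight into `b`
    -- (`hb1`), while the spread condition caps what it adds (`hb2`).
    refine Containable.branch (U.filter fun v => ¬ weightDeg a {v} < weightDeg w ∅ / (4 * N))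
      (fun v hv => ?_) ?_
    · simp only [Finset.mem_filter, not_lt] at hv
      have hdeg : weightDeg (fun f => b f + linkWeight a v f) ∅ =
          weightDeg b ∅ + weightDeg a {v} := by
        rw [weightDeg_add, weightDeg_link]
        simp
      have hav : weightDeg a {v} ≤ K * weightDeg w ∅ / N :=
        (weightDeg_mono h.a_le).trans (by simpa using hw.deg_le {v} (Finset.singleton_nonempty v))
      push_cast at hb1 hb2
      refine ih _ _ _ (h.pick hw v) (by omega) ?_ ?_ ?_ ?_
      · rw [hdeg]; linarith [hv.2]
      · rw [hdeg]; linarith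
      · exact fun I hI => h𝓘w hI.1
      · rintro I ⟨hI, hvI⟩
        refine ⟨(h𝓘w hI).1, fun e he heI => ?_⟩
        by_cases hbe : b e = 0
        · have hl : linkWeight a v e ≠ 0 := by simpa [hbe] using he
          unfold linkWeight at hl
          split_ifs at hl with hve
          · exact hl rfl
          -- A link edge inside `I` would, with the picked `v ∈ I`, complete an edge of `w` inside
          -- `I`.
          refine (h𝓘w hI).2 (insert v e) (fun h0 => hl ?_) (Finset.insert_subset hvI heI)
          linarith [h.a_nonneg (insert v e), h.a_le (insert v e)]
        · exact (h𝓘b hI).2 e hbe heI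
    · have hhalf := h.half_le_active hw hK hp hp' hW <| hb2.trans <| by
        have h1 : (⌈p * N⌉₊ - (k + 1 : ℕ) : ℝ) ≤ 2 * p * N := by
          have : (0 : ℝ) ≤ ((k + 1 : ℕ) : ℝ) := Nat.cast_nonneg _
          linarith
        calc _ ≤ 2 * p * N * (K * weightDeg w ∅ / N) := by gcongr
          _ = 2 * p * K * weightDeg w ∅ := by field_simp
      refine Containable.leaf _ (U.filter fun v => weightDeg a {v} < weightDeg w ∅ / (4 * N))
        (hQ _ (Finset.filter_subset _ _)
          (card_filter_weightDeg_lt hw hK hN hU hW h.a_nonneg h.a_le hhalf)) ?_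
      rintro I ⟨hI, hdisj⟩ x hx
      have hxU := (h𝓘w hI).1 hx
      have := Finset.disjoint_left.1 hdisj hx
      simp only [Finset.mem_filter, hxU, true_and, not_not] at this
      simp [hxU, this]

/-- **The hypergraph container lemma**, in the form of one round of shrinking. -/
theorem SpreadWeight.containable (i : ℕ) (K : ℝ) (hK : 0 < K) :
    ∃ ε > 0, ∃ p₀ > 0, ∀ (V : Type*) [DecidableEq V] [Fintype V] (w : Finset V → ℝ)
      (U : Finset V) (p N : ℝ), SpreadWeight w (i + 1) U K p N → 0 < weightDeg w ∅ → 0 < p →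
      p ≤ p₀ → 1 ≤ p * N → (U.card : ℝ) ≤ N →
      Containable (fun c => c ⊆ U ∧ (c.card : ℝ) ≤ U.card - ε * N) (i * ⌈p * N⌉₊)
        (indepSets w U) := by
  induction i generalizing K with
  | zero =>
    refine ⟨1 / K, by positivity, 1, one_pos, ?_⟩
    intro V _ _ w U p N hw hW hp _ hpN hU
    classical
    have hN : 0 < N := by
      by_contra hN
      nlinarith [mul_nonneg hp.le (not_lt.1 hN |> neg_nonneg.2)]
    -- In uniformity one no fingerprint is needed: `I` avoids every vertex of nonzero weight, and
    -- there are at least `N / K` of these since each carries at most `K / N` of the total.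
    refine Containable.leaf _ (U.filter fun v => w {v} = 0) ⟨Finset.filter_subset _ _, ?_⟩ ?_
    · have h1 : weightDeg w ∅ = ∑ v ∈ U, weightDeg w {v} := by
        rw [sum_weightDeg_singleton U fun e he => (hw.supp e he).2, weightDeg_empty]
        refine Finset.sum_congr rfl fun e _ => ?_
        by_cases he : w e = 0
        · simp [he]
        · rw [(hw.supp e he).1]; simp
      have h2 : ∀ v, w {v} = 0 → weightDeg w {v} = 0 := fun v hv => by
        refine Finset.sum_eq_zero fun e he => ?_
        by_contra h0
        obtain ⟨x, hx⟩ := Finset.card_eq_one.1 (hw.supp e h0).1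
        simp only [Finset.mem_filter, Finset.mem_univ, true_and, hx,
          Finset.singleton_subset_singleton] at he
        subst he
        rw [hx] at h0
        exact h0 hv
      rw [← Finset.sum_filter_add_sum_filter_not U fun v => w {v} = 0,
        Finset.sum_eq_zero (fun v hv => h2 v (Finset.mem_filter.1 hv).2), zero_add] at h1
      have h3 : weightDeg w ∅ ≤
          ((U.filter fun v => ¬ w {v} = 0).card : ℝ) * (K * weightDeg w ∅ / N) := by
        conv_lhs => rw [h1]
        rw [← nsmul_eq_mul]
        refine Finset.sum_le_card_nsmul _ _ _ fun v _ => ?_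
        simpa using hw.deg_le {v} (Finset.singleton_nonempty v)
      have h4 : ((U.filter fun v => w {v} = 0).card : ℝ) +
          ((U.filter fun v => ¬ w {v} = 0).card : ℝ) = U.card := by
        exact_mod_cast Finset.card_filter_add_card_filter_not (s := U) (p := fun v => w {v} = 0)
      set x := ((U.filter fun v => ¬ w {v} = 0).card : ℝ)
      have h6 : 1 / K * N ≤ x := by
        calc 1 / K * N = weightDeg w ∅ * (N / (K * weightDeg w ∅)) := by field_simp
          _ ≤ x * (K * weightDeg w ∅ / N) * (N / (K * weightDeg w ∅)) := by gcongr
          _ = x := by field_simp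
      linarith
    · intro I hI x hx
      simp only [Finset.mem_filter, hI.1 hx, true_and]
      by_contra h0
      exact hI.2 {x} h0 (by simpa using hx)
  | succ i ih =>
    -- This is the spread constant of the collected links after a complete run.
    obtain ⟨ε, hε, p₀, hp₀, h⟩ := ih (4 * (2 ^ (i + 1 + 3) * K ^ 2 + K)) (by positivity)
    refine ⟨min ε (1 / (4 * K)), by positivity, min p₀ (1 / (8 * K)), by positivity, ?_⟩
    intro V _ _ w U p N hw hW hp hpp hpN hU
    classical
    have hN : 0 < N := by
      by_contra hN
      nlinarith [mul_nonneg hp.le (not_lt.1 hN |> neg_nonneg.2)]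
    have hW0 : weightDeg (fun _ => 0 : Finset V → ℝ) = fun _ => 0 := by
      funext X; simp [weightDeg]
    rw [Nat.succ_mul]
    refine LinkState.containable hw hK hp ?_ hpN hU hW ?_ ?_ _ w (fun _ => 0) _ ?_ le_rfl ?_ ?_
      subset_rfl ?_
    · calc p * (8 * K) ≤ 1 / (8 * K) * (8 * K) := by
            gcongr; exact hpp.trans (min_le_right _ _)
        _ = 1 := by field_simp
    · intro c hc hcc
      refine ⟨hc, hcc.trans ?_⟩
      gcongr
      exact min_le_right _ _
    · intro b hb hb0
      refine (h V b U p N hb hb0 hp (hpp.trans (min_le_left _ _)) hpN hU).imp fun c hc => ?_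
      refine ⟨hc.1, hc.2.trans ?_⟩
      gcongr
      exact min_le_left _ _
    · refine ⟨hw.nonneg, fun _ => le_rfl, fun _ => le_rfl, fun e he => absurd rfl he, ?_, ?_, ?_⟩
      · intro X _
        rw [hW0]
        positivity
      · intro X _ hX
        rw [hW0] at hX
        exact absurd hX (not_lt.2 (by positivity))
      · have := Finset.sum_nonneg (s := Finset.univ.filter fun X : Finset V => X.Nonempty ∧
          2 ^ (i + 1 + 3) * K ^ 2 * p ^ X.card * weightDeg w ∅ / N <
          weightDeg (fun _ => 0 : Finset V → ℝ) X)
          (f := fun X => weightDeg w X) fun X _ => weightDeg_nonneg hw.nonneg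
        have h0 : weightDeg (fun _ => 0 : Finset V → ℝ) ∅ = 0 := by rw [hW0]
        linarith
    · simp [hW0]
    · simp [hW0]
    · exact fun I hI => ⟨hI.1, fun e he => absurd rfl he⟩

/-- Iterating the container lemma: if one round is possible in every set of more than `M`
vertices, then the family has containers with at most `M` vertices. -/
theorem Containable.iterate {V : Type*} [DecidableEq V] {M : ℕ} {s : ℕ} {δ : ℝ}
    {𝓘 : Set (Finset V)} {U₀ : Finset V}
    (h : ∀ U ⊆ U₀, M < U.card →
      Containable (fun c => c ⊆ U ∧ (c.card : ℝ) ≤ U.card - δ) s {I ∈ 𝓘 | I ⊆ U})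
    (k : ℕ) (U : Finset V) (hU₀ : U ⊆ U₀) (hU : (U.card : ℝ) ≤ M + k * δ) :
    Containable (fun c => c.card ≤ M) (k * s) {I ∈ 𝓘 | I ⊆ U} := by
  induction k generalizing U with
  | zero =>
    refine Containable.leaf _ U ?_ fun I hI => hI.2
    simp only [Nat.cast_zero, zero_mul, add_zero] at hU
    exact_mod_cast hU
  | succ k ih =>
    by_cases hM : M < U.card
    · rw [Nat.succ_mul, add_comm]
      refine (h U hU₀ hM).bind fun c hc => ?_
      refine (ih c (hc.1.trans hU₀) ?_).mono le_rfl fun I hI => ⟨hI.1.1, hI.2⟩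
      push_cast at hU
      linarith [hc.2]
    · exact Containable.leaf _ U (not_lt.1 hM) fun I hI => hI.2

end Containers

/-! ### Counting sets through their containers -/

section Counting

/-- Applying recoverability to `J = g I` shows that the fingerprint alone determines the container,
so `I` is given by its fingerprint and the remaining elements inside that container. -/
theorem Containable.card_le {V : Type*} [DecidableEq V] {M s m : ℕ} {𝓘 : Set (Finset V)}
    (h : Containable (fun c => c.card ≤ M) s 𝓘) (U : Finset V)
    (F : Finset (Finset V)) (hF : ∀ I ∈ F, I ∈ 𝓘 ∧ I.card = m ∧ I ⊆ U) :
    F.card ≤ ∑ i ∈ Finset.range (s + 1), U.card.choose i * M.choose (m - i) := by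
  obtain ⟨g, c, h⟩ := h
  have hsub : F ⊆ (Finset.range (s + 1)).biUnion fun i =>
      -- The filter is needed because `c` is uncontrolled on sets that are not fingerprints.
      ((U.powersetCard i).filter fun S => (c S).card ≤ M).biUnion fun S =>
        ((c S).powersetCard (m - i)).image (S ∪ ·) := by
    intro I hI
    obtain ⟨hI1, hI2, hI3⟩ := hF I hI
    obtain ⟨a1, a2, a3, a4, a5⟩ := h I hI1
    obtain ⟨-, b2⟩ := a5 (g I) subset_rfl a1
    simp only [Finset.mem_biUnion, Finset.mem_image, Finset.mem_powersetCard, Finset.mem_range,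
      Finset.mem_filter]
    refine ⟨(g I).card, by omega, g I, ⟨⟨a1.trans hI3, rfl⟩, by rw [b2]; exact a4⟩, I \ g I,
      ⟨?_, ?_⟩, Finset.union_sdiff_of_subset a1⟩
    · rw [b2]; exact Finset.sdiff_subset.trans a3
    · rw [Finset.card_sdiff_of_subset a1, hI2]
  refine (Finset.card_le_card hsub).trans (Finset.card_biUnion_le.trans ?_)
  refine Finset.sum_le_sum fun i _ => ?_
  refine (Finset.card_biUnion_le_card_mul _ _ (M.choose (m - i)) fun S hS => ?_).trans ?_
  · refine Finset.card_image_le.trans ?_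
    rw [Finset.card_powersetCard]
    exact Nat.choose_le_choose _ (Finset.mem_filter.1 hS).2
  · gcongr
    exact (Finset.card_filter_le _ _).trans (Finset.card_powersetCard _ _).le

theorem choose_mul_choose_le (a b i m : ℕ) (h : i ≤ m) :
    a.choose i * b.choose (m - i) ≤ (a + b).choose m := by
  rw [Nat.add_choose_eq]
  exact Finset.single_le_sum (f := fun ij : ℕ × ℕ => a.choose ij.1 * b.choose ij.2)
    (fun _ _ => Nat.zero_le _) (a := (i, m - i)) (by simp [h])

/-- Compare falling factorials factor by factor: `(1 + γ) * (A - j) ≤ A + a - j` for `j < A`. -/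
theorem pow_mul_choose_le (A a m : ℕ) (γ : ℝ) (hγ : 0 ≤ γ) (h : γ * A ≤ a) :
    (1 + γ) ^ m * (A.choose m : ℝ) ≤ ((A + a).choose m : ℝ) := by
  have key : (1 + γ) ^ m * (A.descFactorial m : ℝ) ≤ ((A + a).descFactorial m : ℝ) := by
    induction m with
    | zero => simp
    | succ m ih =>
      rw [Nat.descFactorial_succ, Nat.descFactorial_succ]
      by_cases hm : A ≤ m
      · rw [Nat.sub_eq_zero_of_le hm]
        simp only [zero_mul, Nat.cast_zero, mul_zero]
        positivity
      · push Not at hm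
        have h1 : (1 + γ) * ((A - m : ℕ) : ℝ) ≤ ((A + a - m : ℕ) : ℝ) := by
          rw [Nat.cast_sub hm.le, Nat.cast_sub (by omega)]
          push_cast
          nlinarith [(Nat.cast_nonneg m : (0 : ℝ) ≤ m)]
        push_cast
        calc (1 + γ) ^ (m + 1) * (((A - m : ℕ) : ℝ) * (A.descFactorial m : ℝ))
            = ((1 + γ) * ((A - m : ℕ) : ℝ)) * ((1 + γ) ^ m * (A.descFactorial m : ℝ)) := by ring
          _ ≤ _ := by gcongr
  rw [Nat.descFactorial_eq_factorial_mul_choose, Nat.descFactorial_eq_factorial_mul_choose] at key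
  push_cast at key
  have hf : (0 : ℝ) < (m.factorial : ℝ) := by exact_mod_cast m.factorial_pos
  refine le_of_mul_le_mul_left ?_ hf
  linarith

theorem choose_le_pow_mul_choose (D a i : ℕ) (R : ℝ) (hi : 2 * i ≤ a) (hR : 2 * (D : ℝ) ≤ R * a) :
    (D.choose i : ℝ) ≤ R ^ i * (a.choose i : ℝ) := by
  rcases Nat.eq_zero_or_pos i with rfl | hi0
  · simp
  have ha : (0 : ℝ) < a := by exact_mod_cast (by omega : 0 < a)
  have hR0 : 0 ≤ R := by
    by_contra h
    nlinarith [(Nat.cast_nonneg D : (0 : ℝ) ≤ D)]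
  have hf : (0 : ℝ) < (i.factorial : ℝ) := by exact_mod_cast i.factorial_pos
  have h1 : (D.choose i : ℝ) ≤ (D : ℝ) ^ i / (i.factorial : ℝ) := Nat.choose_le_pow_div i D
  have h2 : (((a + 1 - i : ℕ) : ℝ) ^ i / (i.factorial : ℝ)) ≤ a.choose i := by
    have := Nat.pow_le_choose (α := ℝ) i a
    exact_mod_cast this
  have h3 : (a : ℝ) / 2 ≤ ((a + 1 - i : ℕ) : ℝ) := by
    rw [Nat.cast_sub (by omega)]
    push_cast
    have : 2 * (i : ℝ) ≤ a := by exact_mod_cast hi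
    linarith
  calc (D.choose i : ℝ) ≤ (D : ℝ) ^ i / (i.factorial : ℝ) := h1
    _ ≤ (R * (a / 2)) ^ i / (i.factorial : ℝ) := by gcongr; linarith
    _ = R ^ i * ((a / 2) ^ i / (i.factorial : ℝ)) := by rw [mul_pow]; ring
    _ ≤ R ^ i * (((a + 1 - i : ℕ) : ℝ) ^ i / (i.factorial : ℝ)) := by gcongr
    _ ≤ _ := by gcongr

/-- Three slices of size `a` are spent above `x`: one is the slack of the containers, one absorbs
the fingerprint by Vandermonde after `D` is replaced by `a` at cost `R ^ s`, and one gains the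
factor `(1 + γ) ^ m` that pays for `R ^ s` and for the `s + 1 ≤ 2 ^ s` summands. -/
theorem sum_choose_mul_choose_le (D x a s m : ℕ) (R γ : ℝ) (hsm : s ≤ m) (hs : 2 * s ≤ a)
    (hR1 : 1 ≤ R) (hR : 2 * (D : ℝ) ≤ R * a) (hγ : 0 ≤ γ) (hγ' : γ * (x + 2 * a) ≤ a)
    (hpow : (2 * R) ^ s ≤ (1 + γ) ^ m) :
    ∑ i ∈ Finset.range (s + 1), D.choose i * (x + a).choose (m - i) ≤ (x + 3 * a).choose m := by
  have h1 : ∀ i ∈ Finset.range (s + 1), ((D.choose i * (x + a).choose (m - i) : ℕ) : ℝ) ≤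
      R ^ s * ((x + 2 * a).choose m : ℝ) := by
    intro i hi
    rw [Finset.mem_range] at hi
    have h2 := choose_le_pow_mul_choose D a i R (by omega) hR
    have h3 : ((a.choose i * (x + a).choose (m - i) : ℕ) : ℝ) ≤ ((x + 2 * a).choose m : ℝ) := by
      have := choose_mul_choose_le a (x + a) i m (by omega)
      rw [show a + (x + a) = x + 2 * a by ring] at this
      exact_mod_cast this
    push_cast at h3 ⊢
    calc (D.choose i : ℝ) * ((x + a).choose (m - i) : ℝ)
        ≤ R ^ i * (a.choose i : ℝ) * ((x + a).choose (m - i) : ℝ) := by gcongr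
      _ = R ^ i * ((a.choose i : ℝ) * ((x + a).choose (m - i) : ℝ)) := by ring
      _ ≤ R ^ s * _ := by
        refine mul_le_mul ?_ h3 (by positivity) (by positivity)
        exact pow_le_pow_right₀ hR1 (by omega)
  have h4 := pow_mul_choose_le (x + 2 * a) a m γ hγ (by push_cast; exact hγ')
  rw [show x + 2 * a + a = x + 3 * a by ring] at h4
  have h5 : ((s + 1 : ℕ) : ℝ) ≤ 2 ^ s := by exact_mod_cast Nat.lt_two_pow_self (n := s)
  have : ((∑ i ∈ Finset.range (s + 1), D.choose i * (x + a).choose (m - i) : ℕ) : ℝ) ≤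
      ((x + 3 * a).choose m : ℝ) := by
    rw [Nat.cast_sum]
    calc _ ≤ _ := Finset.sum_le_sum h1
      _ = ((s + 1 : ℕ) : ℝ) * (R ^ s * ((x + 2 * a).choose m : ℝ)) := by simp
      _ ≤ 2 ^ s * (R ^ s * ((x + 2 * a).choose m : ℝ)) := by gcongr
      _ = (2 * R) ^ s * ((x + 2 * a).choose m : ℝ) := by rw [mul_pow]; ring
      _ ≤ (1 + γ) ^ m * ((x + 2 * a).choose m : ℝ) := by gcongr
      _ ≤ _ := h4
  exact_mod_cast this

end Counting

/-! ### Turán numbers of families and supersaturation -/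

section Supersaturation

variable {X : Type*}

/-- The edges of the copy of `E` given by the embedding `φ`. -/
def copyEdges {β : Type*} [DecidableEq β] (E : Finset (Finset X)) (φ : X ↪ β) :
    Finset (Finset β) :=
  E.image fun e => e.map φ

/-- The family `G` contains no copy of `E`. -/
def FreeOf {β : Type*} [DecidableEq β] (E : Finset (Finset X)) (G : Finset (Finset β)) : Prop :=
  ∀ φ : X ↪ β, ¬ copyEdges E φ ⊆ G

open Classical in
/-- The largest size of an `E`-free family of `t`-subsets of `Fin n`. -/
noncomputable def exNum (t : ℕ) (E : Finset (Finset X)) (n : ℕ) : ℕ :=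
  ((Finset.powersetCard t (Finset.univ : Finset (Fin n))).powerset.filter (FreeOf E)).sup
    Finset.card

variable {t : ℕ} {E : Finset (Finset X)} {n : ℕ}

theorem FreeOf.mono {β : Type*} [DecidableEq β] {G G' : Finset (Finset β)} (h : FreeOf E G)
    (hG : G' ⊆ G) : FreeOf E G' := fun φ hφ => h φ (hφ.trans hG)

theorem FreeOf.card_le_exNum {G : Finset (Finset (Fin n))} (h : FreeOf E G)
    (hG : G ⊆ Finset.powersetCard t Finset.univ) : G.card ≤ exNum t E n := by
  classical
  unfold exNum
  exact Finset.le_sup (f := Finset.card)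
    (Finset.mem_filter.2 ⟨Finset.mem_powerset.2 hG, h⟩)

theorem exists_freeOf_card_eq (hE : E.Nonempty) : ∃ G : Finset (Finset (Fin n)), FreeOf E G ∧
    G ⊆ Finset.powersetCard t Finset.univ ∧ G.card = exNum t E n := by
  classical
  have hne : ((Finset.powersetCard t (Finset.univ : Finset (Fin n))).powerset.filter
      (FreeOf E)).Nonempty := by
    refine ⟨∅, Finset.mem_filter.2 ⟨by simp, fun φ hφ => ?_⟩⟩
    have := hE.image fun e => e.map φ
    rw [copyEdges, Finset.subset_empty] at hφ
    rw [hφ] at this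
    exact Finset.not_nonempty_empty this
  obtain ⟨G, hG, hGc⟩ := Finset.exists_mem_eq_sup _ hne Finset.card
  rw [Finset.mem_filter, Finset.mem_powerset] at hG
  exact ⟨G, hG.2, hG.1, hGc.symm⟩

theorem exNum_le_choose : exNum t E n ≤ n.choose t := by
  classical
  unfold exNum
  refine Finset.sup_le fun G hG => ?_
  have := Finset.card_le_card (Finset.mem_powerset.1 (Finset.mem_filter.1 hG).1)
  simpa using this

/-- More than `exNum t E k` edges inside a `k`-set contain a copy. -/
theorem exists_copy_of_exNum_lt [Fintype X] {k : ℕ} {M : Finset (Fin n)} (hM : M.card = k)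
    {G : Finset (Finset (Fin n))} (hG : G ⊆ Finset.powersetCard t M) (h : exNum t E k < G.card) :
    ∃ φ : X ↪ Fin n, copyEdges E φ ⊆ G ∧ Finset.univ.map φ ⊆ M := by
  classical
  set ψ : Fin k ↪ Fin n := (M.orderEmbOfFin hM).toEmbedding with hψ
  have hrange : Finset.univ.map ψ = M := by
    ext x
    simp [hψ]
  set G' := (Finset.powersetCard t (Finset.univ : Finset (Fin k))).filter fun e => e.map ψ ∈ G
  have hcard : G.card ≤ G'.card := by
    have hsub : G ⊆ G'.image fun e => e.map ψ := by
      intro e he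
      obtain ⟨he1, he2⟩ := Finset.mem_powersetCard.1 (hG he)
      rw [← hrange] at he1
      obtain ⟨e', -, rfl⟩ := Finset.subset_map_iff.1 he1
      refine Finset.mem_image.2 ⟨e', ?_, rfl⟩
      simp only [G', Finset.mem_filter, Finset.mem_powersetCard, Finset.subset_univ, true_and]
      exact ⟨by simpa using he2, he⟩
    exact (Finset.card_le_card hsub).trans Finset.card_image_le
  have hnf : ¬ FreeOf E G' := fun hf =>
    absurd (hf.card_le_exNum (Finset.filter_subset _ _)) (not_le.2 (h.trans_le hcard))
  unfold FreeOf at hnf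
  push Not at hnf
  obtain ⟨φ, hφ⟩ := hnf
  refine ⟨φ.trans ψ, ?_, ?_⟩
  · intro e he
    obtain ⟨e', he', rfl⟩ := Finset.mem_image.1 he
    have := hφ (Finset.mem_image_of_mem _ he')
    rw [← Finset.map_map]
    exact (Finset.mem_filter.1 this).2
  · have hsub : (Finset.univ.map φ).map ψ ⊆ Finset.univ.map ψ :=
      Finset.map_subset_map.2 (Finset.subset_univ _)
    rwa [hrange, Finset.map_map] at hsub

theorem card_powersetCard_filter_superset {β : Type*} [DecidableEq β] [Fintype β] (e : Finset β)
    (k : ℕ) (hk : e.card ≤ k) :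
    ((Finset.powersetCard k (Finset.univ : Finset β)).filter fun M => e ⊆ M).card =
      (Fintype.card β - e.card).choose (k - e.card) := by
  rw [← Finset.card_compl, ← Finset.card_powersetCard]
  refine Finset.card_nbij' (fun M => M \ e) (fun M => M ∪ e) ?_ ?_ ?_ ?_
  · intro M hM
    simp only [Finset.coe_filter, Set.mem_ofPred_eq, Finset.mem_powersetCard, Finset.subset_univ,
      true_and, Finset.mem_coe] at hM ⊢
    refine ⟨fun x hx => ?_, ?_⟩
    · simpa using (Finset.mem_sdiff.1 hx).2
    · rw [Finset.card_sdiff_of_subset hM.2, hM.1]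
  · intro M hM
    simp only [Finset.coe_filter, Set.mem_ofPred_eq, Finset.mem_powersetCard, Finset.subset_univ,
      true_and, Finset.mem_coe] at hM ⊢
    refine ⟨?_, Finset.subset_union_right⟩
    have hd : Disjoint M e := Finset.disjoint_left.2 fun x hx => by simpa using hM.1 hx
    rw [Finset.card_union_of_disjoint hd, hM.2]
    omega
  · intro M hM
    simp only [Finset.coe_filter, Set.mem_ofPred_eq] at hM
    exact Finset.sdiff_union_of_subset hM.2
  · intro M hM
    simp only [Finset.mem_coe, Finset.mem_powersetCard] at hM
    have hd : Disjoint M e := Finset.disjoint_left.2 fun x hx => by simpa using hM.1 hx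
    exact Finset.union_sdiff_cancel_right hd

open Classical in
/-- The `k`-sets inducing more than `exNum t E k` edges of `G`. -/
noncomputable def denseSets (t : ℕ) (E : Finset (Finset X)) (k : ℕ) (G : Finset (Finset (Fin n))) :
    Finset (Finset (Fin n)) :=
  (Finset.powersetCard k Finset.univ).filter fun M => exNum t E k < (G.filter (· ⊆ M)).card

/-- Double count pairs of an edge of `G` and a `k`-set containing it; a `k`-set that is not dense
contributes at most `exNum t E k`. -/
theorem card_mul_choose_le {k : ℕ} (hk : t ≤ k) {G : Finset (Finset (Fin n))}
    (hG : G ⊆ Finset.powersetCard t Finset.univ) :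
    G.card * (n - t).choose (k - t) ≤
      n.choose k * exNum t E k + (denseSets t E k G).card * k.choose t := by
  classical
  have h1 : ∑ M ∈ Finset.powersetCard k (Finset.univ : Finset (Fin n)),
      (G.filter (· ⊆ M)).card = G.card * (n - t).choose (k - t) := by
    simp_rw [Finset.card_filter]
    rw [Finset.sum_comm]
    simp_rw [← Finset.card_filter]
    rw [← smul_eq_mul, ← Finset.sum_const]
    refine Finset.sum_congr rfl fun e he => ?_
    have he' := (Finset.mem_powersetCard.1 (hG he)).2
    rw [card_powersetCard_filter_superset e k (by omega), he', Fintype.card_fin]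
  rw [← h1]
  have h2 : ∀ M ∈ Finset.powersetCard k (Finset.univ : Finset (Fin n)),
      (G.filter (· ⊆ M)).card ≤
        exNum t E k + if exNum t E k < (G.filter (· ⊆ M)).card then k.choose t else 0 := by
    intro M hM
    split_ifs with h
    · have h3 : G.filter (· ⊆ M) ⊆ Finset.powersetCard t M := fun e he => by
        rw [Finset.mem_filter] at he
        exact Finset.mem_powersetCard.2 ⟨he.2, (Finset.mem_powersetCard.1 (hG he.1)).2⟩
      have := Finset.card_le_card h3
      rw [Finset.card_powersetCard, (Finset.mem_powersetCard.1 hM).2] at this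
      omega
    · omega
  refine (Finset.sum_le_sum h2).trans ?_
  rw [Finset.sum_add_distrib, Finset.sum_const, ← Finset.sum_filter, Finset.sum_const]
  simp [denseSets]

/-- The density at some `k ≥ v` is within `δ` of the least density. -/
theorem exists_exNum_div_choose_le (t : ℕ) (E : Finset (Finset X)) (v : ℕ) {δ : ℝ} (hδ : 0 < δ) :
    ∃ k ≥ v, ∀ n ≥ v,
      (exNum t E k : ℝ) / k.choose t ≤ (exNum t E n : ℝ) / n.choose t + δ := by
  set f : ℕ → ℝ := fun j => (exNum t E (v + j) : ℝ) / (v + j).choose t with hf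
  have hbdd : BddBelow (Set.range f) := ⟨0, by rintro _ ⟨j, rfl⟩; simp only [hf]; positivity⟩
  -- The infimum of the densities is enough; neither their monotonicity nor their convergence is
  -- used.
  obtain ⟨j, hj⟩ := exists_lt_of_ciInf_lt (lt_add_of_pos_right (iInf f) hδ)
  refine ⟨v + j, by omega, fun n hn => ?_⟩
  have h1 := ciInf_le hbdd (n - v)
  simp only [hf] at h1 hj
  rw [show v + (n - v) = n by omega] at h1
  linarith

variable [Fintype X]

open Classical in
/-- The copies of `E` inside `G`. -/
noncomputable def copies (E : Finset (Finset X)) (G : Finset (Finset (Fin n))) :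
    Finset (X ↪ Fin n) :=
  Finset.univ.filter fun φ => copyEdges E φ ⊆ G

/-- Every dense set contains the vertices of some copy, and a fixed copy lies in only `(n -
v).choose (k - v)` sets of size `k`, where `v` is the number of vertices of `X`. -/
theorem card_denseSets_le {k : ℕ} (hk : Fintype.card X ≤ k) {G : Finset (Finset (Fin n))}
    (hG : G ⊆ Finset.powersetCard t Finset.univ) :
    (denseSets t E k G).card ≤
      (copies E G).card * (n - Fintype.card X).choose (k - Fintype.card X) := by
  classical
  have hsub : denseSets t E k G ⊆ (copies E G).biUnion fun φ =>
      (Finset.powersetCard k (Finset.univ : Finset (Fin n))).filter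
        fun M => Finset.univ.map φ ⊆ M := by
    intro M hM
    obtain ⟨hM1, hM2⟩ := Finset.mem_filter.1 hM
    obtain ⟨φ, hφ, hφM⟩ := exists_copy_of_exNum_lt (Finset.mem_powersetCard.1 hM1).2
      (G := G.filter (· ⊆ M)) (fun e he => by
        rw [Finset.mem_filter] at he
        exact Finset.mem_powersetCard.2 ⟨he.2, (Finset.mem_powersetCard.1 (hG he.1)).2⟩) hM2
    refine Finset.mem_biUnion.2 ⟨φ, ?_, Finset.mem_filter.2 ⟨hM1, hφM⟩⟩
    exact Finset.mem_filter.2 ⟨Finset.mem_univ _, hφ.trans (Finset.filter_subset _ _)⟩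
  refine (Finset.card_le_card hsub).trans (Finset.card_biUnion_le_card_mul _ _ _ fun φ _ => ?_)
  rw [card_powersetCard_filter_superset _ _ (by simpa using hk)]
  simp

theorem pow_le_mul_choose {n v : ℕ} (h : 2 * v ≤ n) :
    (n : ℝ) ^ v ≤ 2 ^ v * v.factorial * n.choose v := by
  have h1 : (((n + 1 - v : ℕ) : ℝ) ^ v / (v.factorial : ℝ)) ≤ n.choose v := by
    have := Nat.pow_le_choose (α := ℝ) v n
    exact_mod_cast this
  have hf : (0 : ℝ) < (v.factorial : ℝ) := by exact_mod_cast v.factorial_pos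
  have h3 : (n : ℝ) / 2 ≤ ((n + 1 - v : ℕ) : ℝ) := by
    rw [Nat.cast_sub (by omega)]
    push_cast
    have : 2 * (v : ℝ) ≤ n := by exact_mod_cast h
    linarith
  calc (n : ℝ) ^ v = 2 ^ v * v.factorial * ((n / 2) ^ v / (v.factorial : ℝ)) := by
        rw [div_pow]; field_simp
    _ ≤ 2 ^ v * v.factorial * (((n + 1 - v : ℕ) : ℝ) ^ v / (v.factorial : ℝ)) := by gcongr
    _ ≤ _ := by gcongr

/-- **Supersaturation**. -/
theorem supersaturation (E : Finset (Finset X)) (hv : t ≤ Fintype.card X) {δ : ℝ} (hδ : 0 < δ) :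
    ∃ η > 0, ∃ n₀ : ℕ, ∀ n ≥ n₀, ∀ G : Finset (Finset (Fin n)),
      G ⊆ Finset.powersetCard t Finset.univ → exNum t E n + δ * (n : ℝ) ^ t ≤ G.card →
      η * (n : ℝ) ^ Fintype.card X ≤ (copies E G).card := by
  set v := Fintype.card X with hvdef
  obtain ⟨k, hkv, hk⟩ := exists_exNum_div_choose_le t E v (half_pos hδ)
  have hkt : t ≤ k := hv.trans hkv
  have h1 : (0 : ℝ) < k.choose t := by exact_mod_cast Nat.choose_pos hkt
  have h2 : (0 : ℝ) < k.choose v := by exact_mod_cast Nat.choose_pos hkv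
  have hf : (0 : ℝ) < (v.factorial : ℝ) := by exact_mod_cast v.factorial_pos
  refine ⟨δ / 2 / k.choose v / (2 ^ v * v.factorial), by positivity, max k (2 * v), ?_⟩
  intro n hn G hG hGc
  have hkn : k ≤ n := (le_max_left _ _).trans hn
  have hvn : 2 * v ≤ n := (le_max_right _ _).trans hn
  have h3 : (0 : ℝ) < n.choose t := by exact_mod_cast Nat.choose_pos (hkt.trans hkn)
  have h4 : (0 : ℝ) < (n - v).choose (k - v) := by
    exact_mod_cast Nat.choose_pos (Nat.sub_le_sub_right hkn v)
  have e1 : (n.choose k : ℝ) * k.choose t = n.choose t * (n - t).choose (k - t) := by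
    exact_mod_cast Nat.choose_mul (n := n) hkt
  have e2 : (n.choose k : ℝ) * k.choose v = n.choose v * (n - v).choose (k - v) := by
    exact_mod_cast Nat.choose_mul (n := n) hkv
  have e3 : (G.card : ℝ) * (n - t).choose (k - t) ≤
      n.choose k * exNum t E k + (denseSets t E k G).card * k.choose t := by
    exact_mod_cast card_mul_choose_le hkt hG
  have e4 : ((denseSets t E k G).card : ℝ) ≤
      (copies E G).card * (n - v).choose (k - v) := by
    exact_mod_cast card_denseSets_le hkv hG
  have e5 : ((exNum t E k : ℝ) / k.choose t + δ / 2) * n.choose t ≤ G.card := by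
    have h5 : (n.choose t : ℝ) ≤ (n : ℝ) ^ t := by exact_mod_cast Nat.choose_le_pow n t
    have h6 := hk n (by omega)
    have h7 : (exNum t E n : ℝ) / n.choose t * n.choose t = exNum t E n := by field_simp
    nlinarith
  have e6 : δ / 2 * n.choose k ≤ (denseSets t E k G).card := by
    have h5 : ((exNum t E k : ℝ) / k.choose t + δ / 2) * n.choose t * (n - t).choose (k - t) ≤
        n.choose k * exNum t E k + (denseSets t E k G).card * k.choose t := by
      refine le_trans ?_ e3
      gcongr
    have h6 : ((exNum t E k : ℝ) / k.choose t + δ / 2) * n.choose t * (n - t).choose (k - t) =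
        n.choose k * exNum t E k + δ / 2 * n.choose k * k.choose t := by
      rw [mul_assoc, ← e1]; field_simp
    rw [h6] at h5
    refine le_of_mul_le_mul_right ?_ h1
    linarith
  have e7 : δ / 2 / k.choose v * n.choose v ≤ (copies E G).card := by
    refine le_of_mul_le_mul_right ?_ h4
    calc δ / 2 / k.choose v * n.choose v * (n - v).choose (k - v)
        = δ / 2 / k.choose v * (n.choose v * (n - v).choose (k - v)) := by ring
      _ = δ / 2 * n.choose k := by rw [← e2]; field_simp
      _ ≤ _ := e6.trans e4
  calc δ / 2 / k.choose v / (2 ^ v * v.factorial) * (n : ℝ) ^ v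
      ≤ δ / 2 / k.choose v / (2 ^ v * v.factorial) * (2 ^ v * v.factorial * n.choose v) := by
        gcongr; exact pow_le_mul_choose hvn
    _ = δ / 2 / k.choose v * n.choose v := by field_simp
    _ ≤ _ := e7

end Supersaturation

/-! ### Containers for free families and the upper bound -/

section CountingFree

variable {X : Type*} {t n : ℕ} {E : Finset (Finset X)}

open Classical in
/-- The weight on families of subsets of `Fin n` counting the copies of `E` inside `U`. -/
noncomputable def copyWeight [Fintype X] (E : Finset (Finset X)) (U e : Finset (Finset (Fin n))) : ℝ :=
  ((copies E U).filter fun φ => copyEdges E φ = e).card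

theorem weightDeg_copyWeight [Fintype X] (U S : Finset (Finset (Fin n))) :
    weightDeg (copyWeight E U) S = ((copies E U).filter fun φ => S ⊆ copyEdges E φ).card := by
  classical
  unfold weightDeg copyWeight
  rw [Finset.card_eq_sum_card_fiberwise (f := copyEdges E)
    (t := Finset.univ.filter fun e => S ⊆ e) fun φ hφ => by
      simpa using (Finset.mem_filter.1 hφ).2]
  push_cast
  refine Finset.sum_congr rfl fun e he => ?_
  rw [Finset.filter_filter]
  congr 2
  ext φ
  simp only [Finset.mem_filter, Finset.mem_univ, true_and] at he ⊢
  constructor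
  · rintro ⟨h1, rfl⟩; exact ⟨h1, he, rfl⟩
  · rintro ⟨h1, -, h2⟩; exact ⟨h1, h2⟩

/-- The number of embeddings sending the edges in `J` onto a given family. -/
theorem card_copyEdges_eq_le [Fintype X] [DecidableEq X] (J : Finset (Finset X)) (S : Finset (Finset (Fin n))) :
    (Finset.univ.filter fun φ : X ↪ Fin n => copyEdges J φ = S).card ≤
      Fintype.card X ^ Fintype.card X * n ^ (Fintype.card X - (J.biUnion id).card) := by
  classical
  set Y := J.biUnion id with hY
  rcases (Finset.univ.filter fun φ : X ↪ Fin n => copyEdges J φ = S).eq_empty_or_nonempty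
    with h0 | ⟨φ₀, hφ₀⟩
  · simp [h0]
  -- The image of `Y` is forced to be the union of `S`, so each vertex of `Y` has at most `Y.card`
  -- possible images; only vertices outside `Y` are free in `Fin n`.
  have hB : ∀ φ : X ↪ Fin n, copyEdges J φ = S → S.biUnion id = Y.map φ := by
    intro φ hφ
    rw [← hφ, hY]
    ext x
    simp only [copyEdges, Finset.mem_biUnion, Finset.mem_image, id, Finset.mem_map]
    constructor
    · rintro ⟨_, ⟨e, he, rfl⟩, hx⟩
      obtain ⟨y, hy, rfl⟩ := Finset.mem_map.1 hx
      exact ⟨y, ⟨e, he, hy⟩, rfl⟩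
    · rintro ⟨y, ⟨e, he, hy⟩, rfl⟩
      exact ⟨_, ⟨e, he, rfl⟩, Finset.mem_map_of_mem _ hy⟩
  have hBcard : (S.biUnion id).card = Y.card := by
    rw [hB φ₀ (Finset.mem_filter.1 hφ₀).2, Finset.card_map]
  have hinj : (Finset.univ.filter fun φ : X ↪ Fin n => copyEdges J φ = S).card ≤
      (Fintype.piFinset fun x : X => if x ∈ Y then S.biUnion id else Finset.univ).card := by
    refine Finset.card_le_card_of_injOn (fun φ => φ) ?_ fun φ _ ψ _ h => DFunLike.coe_injective h
    intro φ hφ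
    have hφ' := (Finset.mem_filter.1 hφ).2
    refine Fintype.mem_piFinset.2 fun x => ?_
    split_ifs with hx
    · rw [hB φ hφ']; exact Finset.mem_map_of_mem _ hx
    · exact Finset.mem_univ _
  refine hinj.trans ?_
  rw [Fintype.card_piFinset]
  have : ∀ x : X, (if x ∈ Y then S.biUnion id else Finset.univ).card =
      if x ∈ Y then Y.card else n := fun x => by
    split_ifs
    · exact hBcard
    · simp
  simp_rw [this]
  rw [Finset.prod_ite, Finset.prod_const, Finset.prod_const]
  have h1 : (Finset.univ.filter fun x => x ∈ Y) = Y := by ext; simp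
  have h2 : (Finset.univ.filter fun x => x ∉ Y) = Yᶜ := by ext; simp
  rw [h1, h2, Finset.card_compl]
  gcongr ?_ * _
  calc Y.card ^ Y.card ≤ Fintype.card X ^ Y.card := by gcongr; exact Finset.card_le_univ _
    _ ≤ _ := by
      rcases Nat.eq_zero_or_pos (Fintype.card X) with h | h
      · have := Finset.card_le_univ Y
        rw [h] at this
        rw [h, Nat.le_zero.1 this]
      · exact Nat.pow_le_pow_right h (Finset.card_le_univ _)

/-- The degree bound for copies of `E`, when `p` is admissible for `E`. -/
theorem weightDeg_copyWeight_le [Fintype X] [DecidableEq X] {p : ℝ} (hn : 0 < n) (hp : 0 ≤ p)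
    (hadm : ∀ J ⊆ E, J.Nonempty →
      (n : ℝ) ^ t ≤ p ^ (J.card - 1) * (n : ℝ) ^ (J.biUnion id).card)
    (U S : Finset (Finset (Fin n))) (hS : S.Nonempty) :
    weightDeg (copyWeight E U) S ≤ 2 ^ E.card * (Fintype.card X : ℝ) ^ Fintype.card X *
      p ^ (S.card - 1) * (n : ℝ) ^ Fintype.card X / (n : ℝ) ^ t := by
  classical
  rw [weightDeg_copyWeight]
  set v := Fintype.card X with hv
  have hn' : (0 : ℝ) < n := by exact_mod_cast hn
  -- Sort the embeddings by the set `J` of edges of `E` that are mapped into `S`; there are at most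
  -- `2 ^ E.card` choices of `J`.
  have hsub : ((copies E U).filter fun φ => S ⊆ copyEdges E φ) ⊆
      (E.powerset.filter fun J => J.card = S.card).biUnion fun J =>
        Finset.univ.filter fun φ : X ↪ Fin n => copyEdges J φ = S := by
    intro φ hφ
    have hφ' := (Finset.mem_filter.1 hφ).2
    have hJ : copyEdges (E.filter fun e => e.map φ ∈ S) φ = S := by
      ext e
      simp only [copyEdges, Finset.mem_image, Finset.mem_filter]
      constructor
      · rintro ⟨e', ⟨-, h⟩, rfl⟩; exact h
      · intro he
        obtain ⟨e', he', rfl⟩ := Finset.mem_image.1 (hφ' he)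
        exact ⟨e', ⟨he', he⟩, rfl⟩
    refine Finset.mem_biUnion.2 ⟨E.filter fun e => e.map φ ∈ S, Finset.mem_filter.2
      ⟨Finset.mem_powerset.2 (Finset.filter_subset _ _), ?_⟩,
      Finset.mem_filter.2 ⟨Finset.mem_univ _, hJ⟩⟩
    conv_rhs => rw [← hJ]
    exact (Finset.card_image_of_injective _ (Finset.map_injective φ)).symm
  have h1 : ∀ J ∈ E.powerset.filter fun J => J.card = S.card,
      ((Finset.univ.filter fun φ : X ↪ Fin n => copyEdges J φ = S).card : ℝ) ≤
        (v : ℝ) ^ v * (p ^ (S.card - 1) * (n : ℝ) ^ v / (n : ℝ) ^ t) := by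
    intro J hJ
    obtain ⟨hJ1, hJ2⟩ := Finset.mem_filter.1 hJ
    have hJne : J.Nonempty := by rw [← Finset.card_pos, hJ2]; exact hS.card_pos
    have h2 : ((Finset.univ.filter fun φ : X ↪ Fin n => copyEdges J φ = S).card : ℝ) ≤
        (v : ℝ) ^ v * (n : ℝ) ^ (v - (J.biUnion id).card) := by
      exact_mod_cast card_copyEdges_eq_le J S
    refine h2.trans ?_
    gcongr
    have h3 := hadm J (Finset.mem_powerset.1 hJ1) hJne
    rw [hJ2] at h3
    rw [le_div_iff₀ (by positivity)]
    have h4 : (n : ℝ) ^ v = (n : ℝ) ^ (v - (J.biUnion id).card) * (n : ℝ) ^ (J.biUnion id).card := by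
      rw [← pow_add, Nat.sub_add_cancel (Finset.card_le_univ _)]
    calc (n : ℝ) ^ (v - (J.biUnion id).card) * (n : ℝ) ^ t
        ≤ (n : ℝ) ^ (v - (J.biUnion id).card) *
          (p ^ (S.card - 1) * (n : ℝ) ^ (J.biUnion id).card) := by gcongr
      _ = p ^ (S.card - 1) * (n : ℝ) ^ v := by rw [h4]; ring
  have h5 : ((E.powerset.filter fun J => J.card = S.card).card : ℝ) ≤ 2 ^ E.card := by
    have := Finset.card_filter_le E.powerset fun J => J.card = S.card
    rw [Finset.card_powerset] at this
    exact_mod_cast this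
  calc (((copies E U).filter fun φ => S ⊆ copyEdges E φ).card : ℝ)
      ≤ ∑ J ∈ E.powerset.filter (fun J => J.card = S.card),
        ((Finset.univ.filter fun φ : X ↪ Fin n => copyEdges J φ = S).card : ℝ) := by
        exact_mod_cast (Finset.card_le_card hsub).trans Finset.card_biUnion_le
    _ ≤ ∑ J ∈ E.powerset.filter (fun J => J.card = S.card),
        (v : ℝ) ^ v * (p ^ (S.card - 1) * (n : ℝ) ^ v / (n : ℝ) ^ t) := Finset.sum_le_sum h1
    _ = ((E.powerset.filter fun J => J.card = S.card).card : ℝ) *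
        ((v : ℝ) ^ v * (p ^ (S.card - 1) * (n : ℝ) ^ v / (n : ℝ) ^ t)) := by
        rw [Finset.sum_const, nsmul_eq_mul]
    _ ≤ 2 ^ E.card * ((v : ℝ) ^ v * (p ^ (S.card - 1) * (n : ℝ) ^ v / (n : ℝ) ^ t)) := by
        gcongr
    _ = _ := by ring

/-- The container theorem for `E`-free families. -/
theorem containable_freeOf [Fintype X] [DecidableEq X] (E : Finset (Finset X)) (hE : E.Nonempty) (hv : t ≤ Fintype.card X)
    (hX : 0 < Fintype.card X) {δ : ℝ} (hδ : 0 < δ) :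
    ∃ T : ℕ, ∃ p₀ > 0, ∃ n₀ : ℕ, ∀ n ≥ n₀, ∀ p : ℝ, 0 < p → p ≤ p₀ → 1 ≤ p * (n : ℝ) ^ t →
      (∀ J ⊆ E, J.Nonempty →
        (n : ℝ) ^ t ≤ p ^ (J.card - 1) * (n : ℝ) ^ (J.biUnion id).card) →
      ∀ M : ℕ, exNum t E n + δ * (n : ℝ) ^ t ≤ M →
      Containable (fun c => c.card ≤ M) (T * ⌈p * (n : ℝ) ^ t⌉₊)
        {I : Finset (Finset (Fin n)) | FreeOf E I ∧ I ⊆ Finset.powersetCard t Finset.univ} := by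
  classical
  obtain ⟨η, hη, n₀, hsup⟩ := supersaturation E hv hδ
  obtain ⟨i, hi⟩ : ∃ i, E.card = i + 1 := ⟨E.card - 1, by have := hE.card_pos; omega⟩
  have hX' : (0 : ℝ) < Fintype.card X := by exact_mod_cast hX
  -- The codegree constant divided by the proportion `η` of embeddings that supersaturation
  -- guarantees.
  set K : ℝ := 2 ^ E.card * (Fintype.card X : ℝ) ^ Fintype.card X / η with hK
  obtain ⟨ε, hε, p₀, hp₀, hcont⟩ := SpreadWeight.containable.{0} i K (by positivity)
  -- Each round removes `ε * n ^ t` of at most `n ^ t` vertices, so `⌈1 / ε⌉₊` rounds suffice.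
  refine ⟨⌈1 / ε⌉₊ * i, p₀, hp₀, max n₀ 1, fun n hn p hp hpp hpn hadm M hM => ?_⟩
  have hn0 : n₀ ≤ n := (le_max_left _ _).trans hn
  have hn1 : 0 < n := (le_max_right _ _).trans hn
  have hnr : (0 : ℝ) < n := by exact_mod_cast hn1
  have hround : ∀ U ⊆ Finset.powersetCard t (Finset.univ : Finset (Fin n)), M < U.card →
      Containable (fun c => c ⊆ U ∧ (c.card : ℝ) ≤ U.card - ε * (n : ℝ) ^ t)
        (i * ⌈p * (n : ℝ) ^ t⌉₊) {I ∈ {I : Finset (Finset (Fin n)) | FreeOf E I ∧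
          I ⊆ Finset.powersetCard t Finset.univ} | I ⊆ U} := by
    intro U hU hMU
    have hcount : η * (n : ℝ) ^ Fintype.card X ≤ weightDeg (copyWeight E U) ∅ := by
      rw [weightDeg_copyWeight]
      simp only [Finset.empty_subset, Finset.filter_true]
      refine hsup n hn0 U hU (hM.trans ?_)
      exact_mod_cast hMU.le
    have hspread : SpreadWeight (copyWeight E U) (i + 1) U K p ((n : ℝ) ^ t) := by
      refine ⟨fun e => Nat.cast_nonneg _, fun e he => ?_, fun S hS => ?_⟩
      · have : ((copies E U).filter fun φ => copyEdges E φ = e).Nonempty := by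
          rw [← Finset.card_pos, Nat.pos_iff_ne_zero]
          exact fun h0 => he (by simp [copyWeight, h0])
        obtain ⟨φ, hφ⟩ := this
        obtain ⟨hφ1, rfl⟩ := Finset.mem_filter.1 hφ
        refine ⟨?_, (Finset.mem_filter.1 hφ1).2⟩
        rw [← hi]
        exact Finset.card_image_of_injective _ (Finset.map_injective φ)
      · refine (weightDeg_copyWeight_le hn1 hp.le hadm U S hS).trans ?_
        gcongr ?_ / _
        calc 2 ^ E.card * (Fintype.card X : ℝ) ^ Fintype.card X * p ^ (S.card - 1) *
              (n : ℝ) ^ Fintype.card X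
            = K * p ^ (S.card - 1) * (η * (n : ℝ) ^ Fintype.card X) := by
              rw [hK]; field_simp
          _ ≤ _ := by gcongr
    refine (hcont _ (copyWeight E U) U p ((n : ℝ) ^ t) hspread
      (lt_of_lt_of_le (by positivity) hcount) hp hpp hpn ?_).mono le_rfl ?_
    · have := Finset.card_le_card hU
      rw [Finset.card_powersetCard, Finset.card_univ, Fintype.card_fin] at this
      exact_mod_cast this.trans (Nat.choose_le_pow n t)
    · rintro I ⟨⟨hI1, -⟩, hI2⟩
      refine ⟨hI2, fun e he heI => ?_⟩
      have : ((copies E U).filter fun φ => copyEdges E φ = e).Nonempty := by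
        rw [← Finset.card_pos, Nat.pos_iff_ne_zero]
        exact fun h0 => he (by simp [copyWeight, h0])
      obtain ⟨φ, hφ⟩ := this
      obtain ⟨-, rfl⟩ := Finset.mem_filter.1 hφ
      exact hI1 φ heI
  rw [mul_assoc]
  refine (Containable.iterate hround ⌈1 / ε⌉₊ (Finset.powersetCard t Finset.univ) subset_rfl
    ?_).mono le_rfl fun I hI => ⟨hI, hI.2⟩
  rw [Finset.card_powersetCard, Finset.card_univ, Fintype.card_fin]
  have h1 : (n.choose t : ℝ) ≤ (n : ℝ) ^ t := by exact_mod_cast Nat.choose_le_pow n t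
  have h2 : 1 ≤ ⌈1 / ε⌉₊ * ε := by
    calc (1 : ℝ) = 1 / ε * ε := by field_simp
      _ ≤ _ := by gcongr; exact Nat.le_ceil _
  calc (n.choose t : ℝ) ≤ 1 * (n : ℝ) ^ t := by rw [one_mul]; exact h1
    _ ≤ ⌈1 / ε⌉₊ * ε * (n : ℝ) ^ t := by gcongr
    _ = 0 + ⌈1 / ε⌉₊ * (ε * (n : ℝ) ^ t) := by ring
    _ ≤ _ := by gcongr; exact Nat.cast_nonneg _

open Classical in
/-- The `E`-free families of `m` subsets of `Fin n` of size `t`. -/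
noncomputable def freeFamilies (t : ℕ) (E : Finset (Finset X)) (n m : ℕ) :
    Finset (Finset (Finset (Fin n))) :=
  (Finset.powersetCard m (Finset.powersetCard t Finset.univ)).filter (FreeOf E)

theorem card_freeFamilies_le (m : ℕ) :
    (freeFamilies t E n m).card ≤ (n.choose t).choose m := by
  classical
  refine (Finset.card_filter_le _ _).trans ?_
  simp

theorem choose_exNum_le_card_freeFamilies (hE : E.Nonempty) (m : ℕ) :
    (exNum t E n).choose m ≤ (freeFamilies t E n m).card := by
  classical
  obtain ⟨G, hG1, hG2, hG3⟩ := exists_freeOf_card_eq (t := t) (n := n) hE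
  rw [← hG3, ← Finset.card_powersetCard]
  refine Finset.card_le_card fun I hI => ?_
  obtain ⟨h1, h2⟩ := Finset.mem_powersetCard.1 hI
  exact Finset.mem_filter.2 ⟨Finset.mem_powersetCard.2 ⟨h1.trans hG2, h2⟩, hG1.mono h1⟩

/-- The upper bound on the number of free families, with `θ` in place of `1 / m_t`. -/
theorem exists_card_freeFamilies_le [Fintype X] [DecidableEq X] (E : Finset (Finset X)) (hE : E.Nonempty)
    (ht : 1 ≤ t) (hv : t ≤ Fintype.card X) {θ : ℝ} (hθ : 0 < θ) (hθt : θ ≤ t)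
    (hadm : ∀ J ⊆ E, J.Nonempty → (J.card - 1 : ℝ) * θ ≤ (J.biUnion id).card - t)
    {δ : ℝ} (hδ : 0 < δ) :
    ∃ C : ℝ, 0 < C ∧ ∀ n m : ℕ, C * (n : ℝ) ^ ((t : ℝ) - θ) ≤ m →
      (freeFamilies t E n m).card ≤ (⌊(exNum t E n : ℝ) + δ * (n : ℝ) ^ t⌋₊).choose m := by
  classical
  -- A third of `δ` for each of the three slices in `sum_choose_mul_choose_le`.
  set δ₁ : ℝ := min δ 1 / 3 with hδ₁
  have hδ₁0 : 0 < δ₁ := by positivity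
  have hδ₁1 : δ₁ ≤ 1 := by
    have := min_le_right δ 1
    linarith
  have hδ₁δ : 3 * δ₁ ≤ δ := by
    have := min_le_left δ 1
    linarith
  obtain ⟨T, p₀, hp₀, n₀, hcont⟩ := containable_freeOf E hE hv (by omega) (half_pos hδ₁0)
  set R : ℝ := 4 / δ₁ with hR
  set γ : ℝ := δ₁ / 6 with hγ
  have hγ0 : 0 < γ := by positivity
  -- `B` elements of `I` pay for one fingerprint element: `m ≥ B * s` gives `(2 * R) ^ s ≤ (1 + γ) ^
  -- m`.
  obtain ⟨B, hB⟩ := pow_unbounded_of_one_lt (2 * R) (by linarith : 1 < 1 + γ)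
  have hR1 : 1 ≤ R := by rw [hR, le_div_iff₀ hδ₁0]; linarith
  have hev : ∀ᶠ n : ℕ in Filter.atTop, (n : ℝ) ^ (-θ) ≤ min p₀ (δ₁ / (8 * (T + 1))) :=
    ((tendsto_rpow_neg_atTop hθ).comp tendsto_natCast_atTop_atTop).eventually
      (eventually_le_nhds (by positivity))
  obtain ⟨n₁, hn₁⟩ := Filter.eventually_atTop.1 hev
  set n₂ : ℕ := max (max n₀ n₁) (max 1 ⌈2 / δ₁⌉₊) with hn₂
  -- The first summand gives `m ≥ (B + 1) * s`; the others make `m` exceed the number of `t`-sets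
  -- when `0 < n < n₂`, so that there is nothing to count.
  refine ⟨2 * T * (B + 1) + (n₂ : ℝ) ^ t + 1, by positivity, fun n m hm => ?_⟩
  rcases Nat.eq_zero_or_pos m with rfl | hm0
  · refine (card_freeFamilies_le 0).trans (by simp)
  -- At `n = 0` the threshold vanishes when `θ < t`, so this case cannot rely on `hm`.
  rcases Nat.eq_zero_or_pos n with rfl | hn0
  · refine (card_freeFamilies_le m).trans ?_
    rw [Nat.choose_eq_zero_of_lt (show 0 < t by omega), Nat.choose_eq_zero_of_lt hm0]
    exact Nat.zero_le _
  have hnr : (1 : ℝ) ≤ n := by exact_mod_cast hn0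
  have hnpos : (0 : ℝ) < n := by linarith
  have hone : 1 ≤ (n : ℝ) ^ ((t : ℝ) - θ) := Real.one_le_rpow hnr (by linarith)
  by_cases hsmall : n < n₂
  · refine (card_freeFamilies_le m).trans ?_
    rw [Nat.choose_eq_zero_of_lt]
    · exact Nat.zero_le _
    have h1 : ((n.choose t : ℕ) : ℝ) ≤ (n₂ : ℝ) ^ t := by
      exact_mod_cast (Nat.choose_le_pow n t).trans (Nat.pow_le_pow_left hsmall.le t)
    have h2 : (n₂ : ℝ) ^ t + 1 ≤ m := by
      refine le_trans ?_ hm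
      have : (0 : ℝ) ≤ 2 * T * (B + 1) := by positivity
      nlinarith [pow_nonneg (Nat.cast_nonneg n₂ : (0 : ℝ) ≤ n₂) t]
    exact_mod_cast (by linarith : ((n.choose t : ℕ) : ℝ) < m)
  push Not at hsmall
  simp only [hn₂, max_le_iff] at hsmall
  obtain ⟨⟨hnn₀, hnn₁⟩, -, hnn₂⟩ := hsmall
  set p : ℝ := (n : ℝ) ^ (-θ) with hp
  have hp0 : 0 < p := by positivity
  have hple := hn₁ n hnn₁
  have hpN : p * (n : ℝ) ^ t = (n : ℝ) ^ ((t : ℝ) - θ) := by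
    rw [hp, ← Real.rpow_natCast, ← Real.rpow_add hnpos]
    congr 1; ring
  set N : ℝ := (n : ℝ) ^ t with hN
  have hNn : (n : ℝ) ≤ N := by
    rw [hN]; exact le_self_pow₀ hnr (by omega)
  have hN0 : 0 < N := by positivity
  have hδN : 2 ≤ δ₁ * N := by
    have h1 : 2 / δ₁ ≤ n := (Nat.le_ceil _).trans (by exact_mod_cast hnn₂)
    rw [div_le_iff₀ hδ₁0] at h1
    nlinarith
  set a : ℕ := ⌊δ₁ * N⌋₊ with ha
  have ha1 : (a : ℝ) ≤ δ₁ * N := Nat.floor_le (by positivity)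
  have ha2 : δ₁ / 2 * N ≤ a := by
    have := Nat.lt_floor_add_one (δ₁ * N)
    rw [← ha] at this
    linarith
  set x := exNum t E n with hx
  have hxN : (x : ℝ) ≤ N := by
    rw [hN]; exact_mod_cast exNum_le_choose.trans (Nat.choose_le_pow n t)
  have hDN : ((n.choose t : ℕ) : ℝ) ≤ N := by rw [hN]; exact_mod_cast Nat.choose_le_pow n t
  have hpN1 : 1 ≤ p * N := by rw [hpN]; exact hone
  set s : ℕ := T * ⌈p * N⌉₊ with hs
  have hs1 : (s : ℝ) ≤ 2 * T * (p * N) := by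
    have : (⌈p * N⌉₊ : ℝ) ≤ 2 * (p * N) := by
      have := Nat.ceil_lt_add_one (show 0 ≤ p * N by positivity)
      linarith
    rw [hs]; push_cast
    calc (T : ℝ) * ⌈p * N⌉₊ ≤ T * (2 * (p * N)) := by gcongr
      _ = _ := by ring
  have hsm : (B + 1) * s ≤ m := by
    have : ((B + 1) * s : ℝ) ≤ m := by
      calc ((B : ℝ) + 1) * s ≤ (B + 1) * (2 * T * (p * N)) := by gcongr
        _ = 2 * T * (B + 1) * (n : ℝ) ^ ((t : ℝ) - θ) := by rw [← hpN]; ring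
        _ ≤ (2 * T * (B + 1) + (n₂ : ℝ) ^ t + 1) * (n : ℝ) ^ ((t : ℝ) - θ) := by
          gcongr
          have := pow_nonneg (Nat.cast_nonneg n₂ : (0 : ℝ) ≤ n₂) t
          linarith
        _ ≤ m := hm
    exact_mod_cast this
  have hc : Containable (fun c => c.card ≤ x + a) s
      {I : Finset (Finset (Fin n)) | FreeOf E I ∧ I ⊆ Finset.powersetCard t Finset.univ} := by
    refine hcont n hnn₀ p hp0 (hple.trans (min_le_left _ _)) hpN1 (fun J hJ hJne => ?_) (x + a) ?_
    · have h1 := hadm J hJ hJne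
      have h2 : ((J.card - 1 : ℕ) : ℝ) = (J.card : ℝ) - 1 := by
        rw [Nat.cast_sub hJne.card_pos]; simp
      -- With `p = n ^ (-θ)`, admissibility is a comparison of exponents of `n`, and this is `hadm`.
      rw [← Real.rpow_natCast, ← Real.rpow_natCast, ← Real.rpow_natCast, hp,
        ← Real.rpow_mul hnpos.le, ← Real.rpow_add hnpos]
      refine Real.rpow_le_rpow_of_exponent_le hnr ?_
      rw [h2]
      linarith
    · push_cast
      linarith
  have hcard := hc.card_le (m := m) (Finset.powersetCard t Finset.univ) (freeFamilies t E n m)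
    fun I hI => by
      obtain ⟨h1, h2⟩ := Finset.mem_filter.1 hI
      obtain ⟨h3, h4⟩ := Finset.mem_powersetCard.1 h1
      exact ⟨⟨h2, h3⟩, h4, h3⟩
  rw [Finset.card_powersetCard, Finset.card_univ, Fintype.card_fin] at hcard
  refine hcard.trans ((sum_choose_mul_choose_le (n.choose t) x a s m R γ ?_ ?_ hR1 ?_ hγ0.le ?_
    ?_).trans (Nat.choose_le_choose _ ?_))
  · exact le_trans (Nat.le_mul_of_pos_left _ (by omega)) hsm
  · have h1 : p ≤ δ₁ / (8 * (T + 1)) := hple.trans (min_le_right _ _)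
    have h2 : 8 * (T + 1) * p ≤ δ₁ := by
      rw [le_div_iff₀ (by positivity)] at h1
      linarith
    have : (2 * s : ℝ) ≤ a := by
      nlinarith [mul_le_mul_of_nonneg_right h2 hN0.le, mul_pos hp0 hN0]
    exact_mod_cast this
  · calc 2 * ((n.choose t : ℕ) : ℝ) ≤ 2 * N := by gcongr
      _ = R * (δ₁ / 2 * N) := by linear_combination (-N / 2) * (div_mul_cancel₀ 4 hδ₁0.ne' : R * δ₁ = 4)
      _ ≤ R * a := by gcongr
  · calc γ * (x + 2 * a) ≤ γ * (N + 2 * N) := by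
          gcongr
          exact ha1.trans (mul_le_of_le_one_left hN0.le hδ₁1)
      _ = δ₁ / 2 * N := by rw [hγ]; ring
      _ ≤ a := ha2
  · calc (2 * R) ^ s ≤ ((1 + γ) ^ B) ^ s := by gcongr
      _ = (1 + γ) ^ (B * s) := (pow_mul _ _ _).symm
      _ ≤ (1 + γ) ^ m := by
        refine pow_le_pow_right₀ (by linarith) (le_trans ?_ hsm)
        exact Nat.mul_le_mul_right _ (by omega)
  · refine Nat.le_floor ?_
    push_cast
    nlinarith

end CountingFree

/-! ### Translation between hypergraphs and families of finite sets -/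

namespace Hypergraph

section Translation

/-- The hypergraph on all of `β` with a given finite family of edges. -/
def ofFamily {β : Type*} (F : Finset (Finset β)) : Hypergraph β where
  vertexSet := Set.univ
  edgeSet := (fun e : Finset β => (e : Set β)) '' F
  subset_vertexSet_of_mem_edgeSet' := fun _ _ => Set.subset_univ _

theorem coe_mem_edgeSet_ofFamily {β : Type*} {F : Finset (Finset β)} {e : Finset β} :
    (e : Set β) ∈ (ofFamily F).edgeSet ↔ e ∈ F := by
  simp [ofFamily]

theorem ofFamily_injective {β : Type*} :
    Function.Injective (ofFamily : Finset (Finset β) → Hypergraph β) := by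
  intro F F' h
  ext e
  rw [← coe_mem_edgeSet_ofFamily, h, coe_mem_edgeSet_ofFamily]

theorem ncard_edgeSet_ofFamily {β : Type*} (F : Finset (Finset β)) :
    (ofFamily F).edgeSet.ncard = F.card := by
  rw [ofFamily, Set.ncard_image_of_injective _ Finset.coe_injective, Set.ncard_coe_finset]

theorem isUniform_ofFamily {β : Type*} [Fintype β] {t : ℕ} {F : Finset (Finset β)} :
    (ofFamily F).IsUniform t ↔ F ⊆ Finset.powersetCard t Finset.univ := by
  simp [IsUniform, ofFamily, Finset.subset_iff, Finset.mem_powersetCard]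

theorem exists_ofFamily_eq {β : Type*} [Fintype β] {G : Hypergraph β}
    (hG : G.vertexSet = Set.univ) : ∃ F, ofFamily F = G := by
  classical
  refine ⟨Finset.univ.filter fun e : Finset β => (e : Set β) ∈ G.edgeSet,
    Hypergraph.ext hG.symm ?_⟩
  ext s
  simp only [ofFamily, Set.mem_image, Finset.coe_filter, Finset.mem_univ, true_and,
    Set.mem_ofPred_eq]
  constructor
  · rintro ⟨e, he, rfl⟩; exact he
  · intro hs
    exact ⟨s.toFinite.toFinset, by simpa using hs, by simp⟩

variable {α : Type*} (H : Hypergraph α)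

open Classical in
/-- The edges of `H` as finite sets of vertices. -/
noncomputable def edgeFamily [Fintype H.vertexSet] : Finset (Finset H.vertexSet) :=
  Finset.univ.filter fun e => Subtype.val '' (e : Set H.vertexSet) ∈ H.edgeSet

variable {H} [Fintype H.vertexSet]

theorem mem_edgeFamily {e : Finset H.vertexSet} :
    e ∈ H.edgeFamily ↔ Subtype.val '' (e : Set H.vertexSet) ∈ H.edgeSet := by
  simp [edgeFamily]

theorem exists_mem_edgeFamily {s : Set α} (hs : s ∈ H.edgeSet) :
    ∃ e ∈ H.edgeFamily, Subtype.val '' (e : Set H.vertexSet) = s := by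
  classical
  have h : Subtype.val '' (((Subtype.val ⁻¹' s : Set H.vertexSet).toFinset : Finset H.vertexSet) :
      Set H.vertexSet) = s := by
    rw [Set.coe_toFinset, Subtype.image_preimage_coe, Set.inter_eq_right]
    exact subset_vertexSet_of_mem_edgeSet hs
  exact ⟨_, mem_edgeFamily.2 (h.symm ▸ hs), h⟩

theorem edgeFamily_nonempty (h : H.edgeSet.Nonempty) : H.edgeFamily.Nonempty :=
  let ⟨_, hs⟩ := h
  let ⟨e, he, _⟩ := exists_mem_edgeFamily hs
  ⟨e, he⟩

theorem card_of_mem_edgeFamily {t : ℕ} (hH : H.IsUniform t) {e : Finset H.vertexSet}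
    (he : e ∈ H.edgeFamily) : e.card = t := by
  have h := hH _ (mem_edgeFamily.1 he)
  rw [Subtype.val_injective.encard_image, Set.encard_coe_eq_coe_finsetCard] at h
  exact_mod_cast h

/-- A copy is given by a map on all of `α`, but only its values on the vertices of `H` matter. An
embedding of the vertex set is extended by a constant, for which a vertex of `H` must exist. -/
theorem containsCopy_ofFamily {β : Type*} [DecidableEq β] [Nonempty H.vertexSet]
    {F : Finset (Finset β)} : (ofFamily F).ContainsCopy H ↔ ¬ FreeOf H.edgeFamily F := by
  unfold FreeOf
  push Not
  constructor
  · rintro ⟨f, hf, -, hsub⟩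
    refine ⟨⟨fun x => f x, fun x y h => Subtype.ext (hf x.2 y.2 h)⟩, fun e he => ?_⟩
    obtain ⟨e', he', rfl⟩ := Finset.mem_image.1 he
    rw [← coe_mem_edgeSet_ofFamily]
    refine hsub ?_
    have := image_mem_edgeSet_image (f := f) (mem_edgeFamily.1 he')
    rw [Set.image_image] at this
    rw [Finset.coe_map]
    exact this
  · rintro ⟨φ, hφ⟩
    have hext : ∀ x : H.vertexSet,
        Function.extend Subtype.val φ (fun _ => φ (Classical.arbitrary _)) (x : α) = φ x :=
      fun x => Subtype.val_injective.extend_apply _ _ _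
    refine ⟨Function.extend Subtype.val φ fun _ => φ (Classical.arbitrary _), ?_,
      Set.subset_univ _, ?_⟩
    · intro x hx y hy h
      have h1 := hext ⟨x, hx⟩
      have h2 := hext ⟨y, hy⟩
      dsimp only at h1 h2
      rw [h1, h2] at h
      exact congrArg Subtype.val (φ.injective h)
    · rintro _ ⟨s, hs, rfl⟩
      obtain ⟨e, he, rfl⟩ := exists_mem_edgeFamily hs
      have := hφ (Finset.mem_image_of_mem _ he)
      rw [← coe_mem_edgeSet_ofFamily] at this
      rw [Set.image_image]
      simp_rw [hext]
      simpa using this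

theorem ofFamily_mem_freeHypergraphs [Nonempty H.vertexSet] {t n : ℕ}
    {F : Finset (Finset (Fin n))} : ofFamily F ∈ freeHypergraphs t n H ↔
      FreeOf H.edgeFamily F ∧ F ⊆ Finset.powersetCard t Finset.univ := by
  simp only [freeHypergraphs, Set.mem_ofPred_eq, containsCopy_ofFamily, isUniform_ofFamily, not_not]
  constructor
  · rintro ⟨-, h1, h2⟩; exact ⟨h2, h1⟩
  · rintro ⟨h1, h2⟩; exact ⟨rfl, h2, h1⟩

theorem numFree_eq [Nonempty H.vertexSet] (t n m : ℕ) :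
    H.numFree t n m = (freeFamilies t H.edgeFamily n m).card := by
  classical
  rw [numFree, ← Set.ncard_coe_finset, ← Set.ncard_image_of_injective _ ofFamily_injective]
  congr 1
  ext G
  simp only [Set.mem_ofPred_eq, Set.mem_image, Finset.mem_coe, freeFamilies, Finset.mem_filter,
    Finset.mem_powersetCard]
  constructor
  · rintro ⟨hG, hm⟩
    obtain ⟨F, rfl⟩ := exists_ofFamily_eq hG.1
    rw [ofFamily_mem_freeHypergraphs] at hG
    rw [ncard_edgeSet_ofFamily] at hm
    exact ⟨F, ⟨⟨hG.2, hm⟩, hG.1⟩, rfl⟩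
  · rintro ⟨F, ⟨⟨h1, h2⟩, h3⟩, rfl⟩
    exact ⟨ofFamily_mem_freeHypergraphs.2 ⟨h3, h1⟩, (ncard_edgeSet_ofFamily F).trans h2⟩

theorem turanNumber_eq [Nonempty H.vertexSet] (hE : H.edgeSet.Nonempty) (t n : ℕ) :
    H.turanNumber t n = exNum t H.edgeFamily n := by
  refine IsGreatest.csSup_eq ⟨?_, ?_⟩
  · obtain ⟨F, h1, h2, h3⟩ := exists_freeOf_card_eq (t := t) (n := n) (edgeFamily_nonempty hE)
    exact ⟨ofFamily F, ofFamily_mem_freeHypergraphs.2 ⟨h1, h2⟩,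
      (ncard_edgeSet_ofFamily F).trans h3⟩
  · rintro _ ⟨G, hG, rfl⟩
    obtain ⟨F, rfl⟩ := exists_ofFamily_eq hG.1
    rw [ofFamily_mem_freeHypergraphs] at hG
    rw [ncard_edgeSet_ofFamily]
    exact hG.1.card_le_exNum hG.2

theorem le_tDensity {t : ℕ} {J : Finset (Finset H.vertexSet)} (hJ : J ⊆ H.edgeFamily)
    {Y : Finset H.vertexSet} (hJY : ∀ e ∈ J, e ⊆ Y) (hY : t + 1 ≤ Y.card) :
    ((J.card : ℝ) - 1) / ((Y.card : ℝ) - t) ≤ tDensity t H := by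
  classical
  have hV : H.vertexSet.Finite := Set.toFinite _
  have hEfin : H.edgeSet.Finite := hV.finite_subsets.subset edgeSet_subset_powerset_vertexSet
  -- Denominators are at least 1, so the supremum is over a set bounded by the number of edges of
  -- `H`.
  refine le_csSup ⟨H.edgeSet.ncard, ?_⟩ ?_
  · rintro _ ⟨H', hH', hv, rfl⟩
    have h1 : (1 : ℝ) ≤ (H'.vertexSet.ncard : ℝ) - t := by
      have : ((t + 1 : ℕ) : ℝ) ≤ (H'.vertexSet.ncard : ℝ) := by exact_mod_cast hv
      push_cast at this
      linarith
    have h2 : (H'.edgeSet.ncard : ℝ) ≤ H.edgeSet.ncard := by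
      exact_mod_cast Set.ncard_le_ncard hH'.2 hEfin
    rw [div_le_iff₀ (by linarith)]
    nlinarith [(Nat.cast_nonneg H.edgeSet.ncard : (0 : ℝ) ≤ _)]
  · let H' : Hypergraph α := {
      vertexSet := Subtype.val '' (Y : Set H.vertexSet)
      edgeSet := (fun e : Finset H.vertexSet => Subtype.val '' (e : Set H.vertexSet)) '' J
      subset_vertexSet_of_mem_edgeSet' := by
        rintro _ ⟨e, he, rfl⟩
        exact Set.image_mono (Finset.coe_subset.2 (hJY e he)) }
    have hv : H'.vertexSet.ncard = Y.card := by
      rw [Set.ncard_image_of_injective _ Subtype.val_injective, Set.ncard_coe_finset]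
    have hinj : Function.Injective
        fun e : Finset H.vertexSet => Subtype.val '' (e : Set H.vertexSet) :=
      Subtype.val_injective.image_injective.comp Finset.coe_injective
    have he : H'.edgeSet.ncard = J.card := by
      rw [Set.ncard_image_of_injective _ hinj, Set.ncard_coe_finset]
    refine ⟨H', ⟨?_, ?_⟩, by rw [hv]; exact hY, by rw [hv, he]⟩
    · rintro _ ⟨x, -, rfl⟩; exact x.2
    · rintro _ ⟨e, he, rfl⟩; exact mem_edgeFamily.1 (hJ he)

end Translation

end Hypergraph

/-! ### Hypergraphs with a single edge -/

section SingleEdge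

variable {X : Type*} [Fintype X] {t n : ℕ}

theorem exNum_eq_choose_of_lt {E : Finset (Finset X)} (h : n < Fintype.card X) :
    exNum t E n = n.choose t := by
  refine le_antisymm exNum_le_choose ?_
  have hf : FreeOf E (Finset.powersetCard t (Finset.univ : Finset (Fin n))) := fun φ =>
    absurd (Fintype.card_le_of_embedding φ) (by simpa using h)
  simpa using hf.card_le_exNum subset_rfl

theorem not_freeOf_singleton {e : Finset X} (he : e.card = t) (h : Fintype.card X ≤ n)
    {F : Finset (Finset (Fin n))} (hF : F ⊆ Finset.powersetCard t Finset.univ)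
    (hne : F.Nonempty) : ¬ FreeOf {e} F := by
  classical
  obtain ⟨f, hf⟩ := hne
  obtain ⟨ψ⟩ : Nonempty (X ↪ Fin n) := Function.Embedding.nonempty_of_card_le (by simpa using h)
  have hcard : (e.map ψ).card = f.card := by
    rw [Finset.card_map, he, (Finset.mem_powersetCard.1 (hF hf)).2]
  -- Any embedding can be corrected by a permutation of `Fin n` that takes the image of `e` to the
  -- given edge `f`.
  let σ : Equiv.Perm (Fin n) := (Finset.equivOfCardEq hcard).extendSubtype
  have hσ : (e.map ψ).map σ.toEmbedding = f := by
    refine Finset.eq_of_subset_of_card_le (fun x hx => ?_) (by rw [Finset.card_map, hcard])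
    obtain ⟨y, hy, rfl⟩ := Finset.mem_map.1 hx
    exact (Finset.equivOfCardEq hcard).extendSubtype_mem y hy
  intro hfree
  refine hfree (ψ.trans σ.toEmbedding) ?_
  rw [copyEdges, Finset.image_singleton, ← Finset.map_map, hσ]
  simpa using hf

/-- Isolated vertices still count: below `Fintype.card X` points every family is free and the Turán
number is the full `n.choose t`; from there on only the empty family is free. No lower bound on `m`
is needed. -/
theorem card_freeFamilies_singleton_le {e : Finset X} (he : e.card = t) {δ : ℝ} (hδ : 0 < δ)
    (m : ℕ) : (freeFamilies t {e} n m).card ≤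
      (⌊(exNum t {e} n : ℝ) + δ * (n : ℝ) ^ t⌋₊).choose m := by
  classical
  rcases Nat.eq_zero_or_pos m with rfl | hm
  · exact (card_freeFamilies_le 0).trans (by simp)
  rcases lt_or_ge n (Fintype.card X) with hn | hn
  · refine (card_freeFamilies_le m).trans (Nat.choose_le_choose _ (Nat.le_floor ?_))
    rw [exNum_eq_choose_of_lt hn]
    have : 0 ≤ δ * (n : ℝ) ^ t := by positivity
    linarith
  · have : freeFamilies t {e} n m = ∅ := by
      refine Finset.filter_eq_empty_iff.2 fun F hF => ?_
      obtain ⟨h1, h2⟩ := Finset.mem_powersetCard.1 hF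
      exact not_freeOf_singleton he hn h1 (Finset.card_pos.1 (by omega))
    simp [this]

end SingleEdge

/-- The union of at least two distinct `t`-sets has more than `t` elements. -/
theorem lt_card_biUnion_of_one_lt {X : Type*} [DecidableEq X] {t : ℕ} {J : Finset (Finset X)}
    (hJ : ∀ e ∈ J, e.card = t) (h : 1 < J.card) : t + 1 ≤ (J.biUnion id).card := by
  obtain ⟨e, he, e', he', hne⟩ := Finset.one_lt_card.1 h
  have h1 : e ⊆ J.biUnion id := Finset.subset_biUnion_of_mem id he
  have h2 : e' ⊆ J.biUnion id := Finset.subset_biUnion_of_mem id he'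
  by_contra hlt
  have h3 : e = J.biUnion id := Finset.eq_of_subset_of_card_le h1 (by rw [hJ e he]; omega)
  have h4 : e' = J.biUnion id := Finset.eq_of_subset_of_card_le h2 (by rw [hJ e' he']; omega)
  exact hne (h3.trans h4.symm)

/-! ### Density bounds and conclusion -/

namespace Hypergraph

variable {α : Type*} {H : Hypergraph α} [Fintype H.vertexSet] {t : ℕ}

/-- Two distinct edges span at most `2 * t` vertices and already have this density. It follows that
`1 / m_t ≤ t`, so the exponent of the threshold is nonnegative. -/
theorem one_div_le_tDensity (hH : H.IsUniform t) (h : 1 < H.edgeFamily.card) :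
    1 / (t : ℝ) ≤ tDensity t H := by
  classical
  obtain ⟨J, hJ, hJ2⟩ := Finset.exists_subset_card_eq (show 2 ≤ H.edgeFamily.card from h)
  have hJt : ∀ e ∈ J, e.card = t := fun e he => card_of_mem_edgeFamily hH (hJ he)
  have hY := lt_card_biUnion_of_one_lt hJt (by omega)
  have hY2 : (J.biUnion id).card ≤ 2 * t := by
    have := Finset.card_biUnion_le_card_mul J id t fun e he => (hJt e he).le
    rwa [hJ2] at this
  refine le_trans ?_ (le_tDensity hJ (fun e he => Finset.subset_biUnion_of_mem id he) hY)
  have h1 : ((t + 1 : ℕ) : ℝ) ≤ ((J.biUnion id).card : ℝ) := by exact_mod_cast hY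
  have h2 : ((J.biUnion id).card : ℝ) ≤ ((2 * t : ℕ) : ℝ) := by exact_mod_cast hY2
  push_cast at h1 h2
  rw [hJ2]
  norm_num
  rw [← one_div, ← one_div]
  exact one_div_le_one_div_of_le (by linarith) (by linarith)

/-- For two or more edges this is the definition of the density applied to `J` on the vertices it
spans; for one edge both sides are zero. -/
theorem card_sub_one_mul_le [DecidableEq H.vertexSet] (hH : H.IsUniform t)
    (hpos : 0 < tDensity t H) {J : Finset (Finset H.vertexSet)} (hJ : J ⊆ H.edgeFamily)
    (hne : J.Nonempty) :
    (J.card - 1 : ℝ) * (1 / tDensity t H) ≤ (J.biUnion id).card - t := by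
  have hJt : ∀ e ∈ J, e.card = t := fun e he => card_of_mem_edgeFamily hH (hJ he)
  rcases Nat.lt_or_ge 1 J.card with h | h
  · have hY := lt_card_biUnion_of_one_lt hJt h
    have h1 := le_tDensity hJ (fun e he => Finset.subset_biUnion_of_mem id he) hY
    have h2 : ((t + 1 : ℕ) : ℝ) ≤ ((J.biUnion id).card : ℝ) := by exact_mod_cast hY
    push_cast at h2
    rw [div_le_iff₀ (by linarith)] at h1
    rw [mul_one_div, div_le_iff₀ hpos]
    linarith
  · have h1 : J.card = 1 := le_antisymm h hne.card_pos
    obtain ⟨e, rfl⟩ := Finset.card_eq_one.1 h1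
    simp [hJt e (Finset.mem_singleton_self e)]

end Hypergraph

/-- The binomial coefficient with the real upper entry `x = ex(n, H) + δ n ^ t` is that with upper
entry `⌊x⌋`. -/
theorem theorem8p1 {α : Type*} (t : ℕ) (ht : 1 ≤ t) (H : Hypergraph α)
    (hfin : H.vertexSet.Finite) (hunif : H.IsUniform t)
    (hvert : t + 1 ≤ H.vertexSet.ncard) (hedge : H.edgeSet.Nonempty)
    (δ : ℝ) (hδ : 0 < δ) :
    ∃ C : ℝ, 0 < C ∧ ∀ n m : ℕ, C * H.edgeThreshold t n ≤ (m : ℝ) →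
      (H.turanNumber t n).choose m ≤ H.numFree t n m ∧
      H.numFree t n m ≤ (⌊(H.turanNumber t n : ℝ) + δ * (n : ℝ) ^ t⌋₊).choose m := by
  classical
  have := hfin.fintype
  have hcard : H.vertexSet.ncard = Fintype.card H.vertexSet := by
    rw [← Nat.card_coe_set_eq, Nat.card_eq_fintype_card]
  have : Nonempty H.vertexSet := Fintype.card_pos_iff.1 (by omega)
  have hE := Hypergraph.edgeFamily_nonempty hedge
  suffices h : ∃ C : ℝ, 0 < C ∧ ∀ n m : ℕ, C * H.edgeThreshold t n ≤ (m : ℝ) →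
      (freeFamilies t H.edgeFamily n m).card ≤
        (⌊(exNum t H.edgeFamily n : ℝ) + δ * (n : ℝ) ^ t⌋₊).choose m by
    obtain ⟨C, hC, h⟩ := h
    refine ⟨C, hC, fun n m hm => ?_⟩
    rw [Hypergraph.turanNumber_eq hedge, Hypergraph.numFree_eq]
    exact ⟨choose_exNum_le_card_freeFamilies hE m, h n m hm⟩
  -- Two edges make the density positive and lead to containers with `θ = 1 / m_t(H)`; with one edge
  -- the bound holds for every `m`, so any `C` works.
  rcases Nat.lt_or_ge 1 H.edgeFamily.card with h1 | h1
  · have ht0 : (0 : ℝ) < t := by exact_mod_cast ht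
    have hdens := Hypergraph.one_div_le_tDensity hunif h1
    have hpos : 0 < H.tDensity t := lt_of_lt_of_le (by positivity) hdens
    obtain ⟨C, hC, h⟩ := exists_card_freeFamilies_le H.edgeFamily hE ht (by omega)
      (one_div_pos.2 hpos) ((one_div_le ht0 hpos).1 hdens)
      (fun J hJ hne => Hypergraph.card_sub_one_mul_le hunif hpos hJ hne) hδ
    refine ⟨C, hC, fun n m hm => h n m ?_⟩
    rwa [Hypergraph.edgeThreshold, if_neg hpos.ne'] at hm
  · obtain ⟨e, he⟩ := Finset.card_eq_one.1 (le_antisymm h1 hE.card_pos)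
    have het : e.card = t :=
      Hypergraph.card_of_mem_edgeFamily hunif (he ▸ Finset.mem_singleton_self e)
    refine ⟨1, one_pos, fun n m _ => ?_⟩
    rw [he]
    exact card_freeFamilies_singleton_le het hδ m
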